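/- For a finite abelian group $G$, a corner in $G\times G$ is a triple of points $\{(x,y),(x+d,y),(x,y+d)\}$ with $x,y,d\in G$ and $d\neq 0$, and $r_{\angle}(G)$ denotes the cardinality of the largest subset of $G\times G$ that contains no corner. There is an absolute constant $C>0$ such that for every integer $n\ge 4$, with $N=2^n=|\mathbb{F}_2^n|$, $$ r_{\angle}(\mathbb{F}_2^n)\;\le\; C\,N^2\,\frac{\log\log\log N}{\log\log N}. $$ (The condition $n\ge 4$ says exactly that $\log\log\log N$ is defined and positive.) -/

import Mathlib

/-- `cornerNumber G` is the cardinality of the largest subset of `G × G` that contains no corner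
`{(x, y), (x + d, y), (x, y + d)}` with `d ≠ 0`. -/
noncomputable def cornerNumber (G : Type*) [AddCommGroup G] [Fintype G] : ℕ :=
  sSup {k : ℕ | ∃ A : Finset (G × G), IsCornerFree (A : Set (G × G)) ∧ A.card = k}

/-- The supremum in the definition of `cornerNumber` is attained. -/
theorem isGreatest_cornerNumber (G : Type*) [AddCommGroup G] [Fintype G] :
    IsGreatest {k : ℕ | ∃ A : Finset (G × G), IsCornerFree (A : Set (G × G)) ∧ A.card = k}
      (cornerNumber G) := by
  have hb : BddAbove
      {k : ℕ | ∃ A : Finset (G × G), IsCornerFree (A : Set (G × G)) ∧ A.card = k} := by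
    refine ⟨Fintype.card (G × G), ?_⟩
    rintro k ⟨A, -, rfl⟩
    exact Finset.card_le_univ A
  have hn : {k : ℕ | ∃ A : Finset (G × G), IsCornerFree (A : Set (G × G)) ∧ A.card = k}.Nonempty :=
    ⟨0, ∅, by simp, rfl⟩
  exact ⟨Nat.sSup_mem hn hb, fun k hk => le_csSup hb hk⟩

/-- Being corner-free, spelled out with the difference `d`. -/
theorem isCornerFree_iff_forall_add {G : Type*} [AddCommGroup G] (A : Set (G × G)) :
    IsCornerFree A ↔
      ¬ ∃ x y d : G, d ≠ 0 ∧ (x, y) ∈ A ∧ (x + d, y) ∈ A ∧ (x, y + d) ∈ A := by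
  constructor
  · rintro h ⟨x, y, d, hd, h₁, h₂, h₃⟩
    have := @h x y (x + d) (y + d) ⟨h₁, h₃, h₂, by abel⟩
    exact hd (by simpa using this)
  · intro h x₁ y₁ x₂ y₂ hc
    by_contra hne
    refine h ⟨x₁, y₁, x₂ - x₁, fun h0 => hne (sub_eq_zero.mp h0).symm,
      hc.fst_fst_mem, ?_, ?_⟩
    · simpa using hc.snd_fst_mem
    · have : y₁ + (x₂ - x₁) = y₂ := by
        have := hc.add_eq_add
        rw [← add_sub_assoc, add_comm y₁ x₂, ← this]
        abel
      rw [this]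
      exact hc.fst_snd_mem

/-! The proof is a density increment on sets `A ⊆ S × T`, where `S` and `T` are Fourier uniform in a
group of exponent two. Writing `z = x + y + d`, a corner consists of `(x, y)`, `(x, z + x)`, `(z +
y, y)`; the last two points lie on the diagonal of coordinate sum `z`. Subtract from `A` the mean of
each column. Since `A` has only the trivial corners `d = 0`, the weighted corner count of the
resulting `f` is very negative. Cauchy–Schwarz, together with uniformity of `T` and then of `S`,
turns this into many pairs of columns `y, y'` with large `∑ x, f x y * f x y'`
(`card_correlated_pairs`). Fixing a good `y`, taking its fibre as `S'` and its partners as `T'`,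
raises the density from `δ` to at least `δ + δ ^ 2 / 8192`, at a cost in size only polynomial in `δ`
(`exists_density_increment`).

The new sides need not be uniform. An energy increment through index-two subgroups restores
uniformity and keeps half of the gain (`CornerCell.exists_uniform`,
`CornerCell.exists_denser_uniform`).

Each round lowers `1 / δ` by at least a constant, so `O(1 / δ₀)` rounds are impossible once the
group is large (`CornerCell.card_lt_of_large`). The relative size of `S × T` stays above `δ₀ ^ O(1 /
δ₀)`, and the dimension lost is polynomial in its inverse. Hence `log n ≥ C (1 / δ₀) log (1 / δ₀)`
suffices, which is the claimed bound because `log n` is essentially `log log N`. -/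

open Finset

/-! ### Characters and Parseval in exponent two -/

/-- The characters of a group of exponent two take the values `1` and `-1`. -/
theorem char_eq_one_or_neg_one {G : Type*} [AddCommGroup G] (h2 : ∀ x : G, x + x = 0)
    (χ : AddChar G ℂ) (x : G) : χ x = 1 ∨ χ x = -1 := by
  have h : χ x * χ x = 1 := by rw [← AddChar.map_add_eq_mul, h2, AddChar.map_zero_eq_one]
  exact mul_self_eq_one_iff.mp h

theorem re_char_eq_one_or_neg_one {G : Type*} [AddCommGroup G] (h2 : ∀ x : G, x + x = 0)
    (χ : AddChar G ℂ) (x : G) : (χ x).re = 1 ∨ (χ x).re = -1 := by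
  rcases char_eq_one_or_neg_one h2 χ x with h | h <;> simp [h]

theorem re_char_add {G : Type*} [AddCommGroup G] (h2 : ∀ x : G, x + x = 0)
    (χ : AddChar G ℂ) (x y : G) : (χ (x + y)).re = (χ x).re * (χ y).re := by
  rw [AddChar.map_add_eq_mul]
  rcases char_eq_one_or_neg_one h2 χ x with h | h <;>
    rcases char_eq_one_or_neg_one h2 χ y with h' | h' <;> simp [h, h']

theorem add_eq_zero_iff_of_exponent_two {G : Type*} [AddCommGroup G] (h2 : ∀ x : G, x + x = 0)
    (x y : G) : x + y = 0 ↔ x = y := by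
  constructor
  · intro h
    have := h2 y
    exact add_right_cancel (h.trans this.symm)
  · rintro rfl
    exact h2 x

/-- Parseval's identity on a group of exponent two. -/
theorem sum_sq_sum_mul_re_char {G : Type*} [AddCommGroup G] [Fintype G]
    (h2 : ∀ x : G, x + x = 0) (f : G → ℝ) :
    ∑ χ : AddChar G ℂ, (∑ x, f x * (χ x).re) ^ 2 = Fintype.card G * ∑ x, f x ^ 2 := by
  classical
  have horth : ∀ x y : G,
      ∑ χ : AddChar G ℂ, (χ x).re * (χ y).re = if x = y then (Fintype.card G : ℝ) else 0 := by
    intro x y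
    have h := congrArg Complex.re (AddChar.sum_apply_eq_ite (x + y))
    rw [Complex.re_sum] at h
    simp only [re_char_add h2] at h
    rw [h]
    simp only [add_eq_zero_iff_of_exponent_two h2]
    split_ifs <;> simp
  calc ∑ χ : AddChar G ℂ, (∑ x, f x * (χ x).re) ^ 2
      = ∑ χ : AddChar G ℂ, ∑ x, ∑ y, f x * f y * ((χ x).re * (χ y).re) := by
        refine sum_congr rfl fun χ _ => ?_
        rw [sq, sum_mul_sum]
        refine sum_congr rfl fun x _ => sum_congr rfl fun y _ => by ring
    _ = ∑ x, ∑ y, f x * f y * ∑ χ : AddChar G ℂ, (χ x).re * (χ y).re := by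
        rw [sum_comm]
        refine sum_congr rfl fun x _ => ?_
        rw [sum_comm]
        refine sum_congr rfl fun y _ => ?_
        rw [mul_sum]
    _ = Fintype.card G * ∑ x, f x ^ 2 := by
        rw [mul_sum]
        refine sum_congr rfl fun x _ => ?_
        simp only [horth, mul_ite, mul_zero, sum_ite_eq, mem_univ, if_true]
        ring

theorem sum_re_char_eq_zero {G : Type*} [AddCommGroup G] [Fintype G]
    {χ : AddChar G ℂ} (hχ : χ ≠ 0) : ∑ x, (χ x).re = 0 := by
  classical
  have h := congrArg Complex.re (AddChar.sum_eq_ite χ)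
  rw [Complex.re_sum, if_neg hχ] at h
  simpa using h

/-! ### Fourier uniformity and correlations with shifts -/

/-- All nontrivial Fourier coefficients of `S` are at most `ε` in absolute value. -/
def FourierUniform {G : Type*} [AddCommGroup G] [Fintype G] (S : Finset G) (ε : ℝ) : Prop :=
  ∀ χ : AddChar G ℂ, χ ≠ 0 → |∑ x ∈ S, (χ x).re| ≤ ε * Fintype.card G

/-- The indicator function of a finite set, with real values. -/
noncomputable def indR {α : Type*} (S : Finset α) (x : α) : ℝ :=
  (S : Set α).indicator 1 x

theorem indR_of_mem {α : Type*} {S : Finset α} {x : α} (h : x ∈ S) : indR S x = 1 := by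
  simp [indR, h]

theorem indR_of_notMem {α : Type*} {S : Finset α} {x : α} (h : x ∉ S) : indR S x = 0 := by
  simp [indR, h]

theorem indR_nonneg {α : Type*} (S : Finset α) (x : α) : 0 ≤ indR S x := by
  by_cases h : x ∈ S <;> simp [indR, h]

theorem indR_le_one {α : Type*} (S : Finset α) (x : α) : indR S x ≤ 1 := by
  by_cases h : x ∈ S <;> simp [indR, h]

theorem indR_mul_self {α : Type*} (S : Finset α) (x : α) : indR S x * indR S x = indR S x := by
  by_cases h : x ∈ S <;> simp [indR, h]

theorem sum_indR_mul {α : Type*} [Fintype α] (S : Finset α) (f : α → ℝ) :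
    ∑ x, indR S x * f x = ∑ x ∈ S, f x := by
  classical
  rw [← sum_subset (subset_univ S) fun x _ hx => by simp [indR_of_notMem hx]]
  exact sum_congr rfl fun x hx => by simp [indR_of_mem hx]

theorem sum_indR {α : Type*} [Fintype α] (S : Finset α) : ∑ x, indR S x = #S := by
  simpa using sum_indR_mul S fun _ => (1 : ℝ)

/-- A Fourier-uniform set has small correlation, on average over shifts, with any bounded
function. -/
theorem FourierUniform.sum_abs_le {G : Type*} [AddCommGroup G] [Fintype G]
    (h2 : ∀ x : G, x + x = 0) {S : Finset G} {ε : ℝ} (hε : 0 ≤ ε) (hS : FourierUniform S ε)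
    (φ : G → ℝ) (hφ : ∀ x, |φ x| ≤ 1) :
    ∑ z, |∑ x, (indR S (z + x) - #S / Fintype.card G) * φ x| ≤ ε * (Fintype.card G : ℝ) ^ 2 := by
  classical
  have hN : (0 : ℝ) < Fintype.card G := by exact_mod_cast Fintype.card_pos
  set N : ℝ := (Fintype.card G : ℝ) with hNdef
  set b : G → ℝ := fun x => indR S x - #S / N with hb
  set h : G → ℝ := fun z => ∑ x, b (z + x) * φ x with hh
  have hbhat : ∀ χ : AddChar G ℂ, |∑ x, b x * (χ x).re| ≤ ε * N := by
    intro χ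
    by_cases hχ : χ = 0
    · subst hχ
      have : ∑ x, b x * ((0 : AddChar G ℂ) x).re = 0 := by
        simp only [AddChar.zero_apply, Complex.one_re, mul_one, hb, sum_sub_distrib, sum_indR,
          sum_const, card_univ, nsmul_eq_mul]
        rw [← hNdef]
        field_simp
        ring
      rw [this, abs_zero]
      positivity
    · have : ∑ x, b x * (χ x).re = ∑ x ∈ S, (χ x).re := by
        simp only [hb, sub_mul, sum_sub_distrib, sum_indR_mul, ← mul_sum,
          sum_re_char_eq_zero hχ, mul_zero, sub_zero]
      rw [this]
      exact hS χ hχ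
  -- `h` is the convolution of `b` and `φ`, as subtraction is addition here, so its transform
  -- factors. Parseval then bounds `∑ h ^ 2`, and Cauchy–Schwarz passes to `∑ |h|`.
  have hhhat : ∀ χ : AddChar G ℂ,
      ∑ z, h z * (χ z).re = (∑ x, b x * (χ x).re) * ∑ x, φ x * (χ x).re := by
    intro χ
    simp only [hh, sum_mul]
    rw [sum_comm, ← sum_mul, mul_sum]
    refine sum_congr rfl fun x _ => ?_
    rw [sum_mul]
    refine (Equiv.sum_comp (Equiv.addRight x) fun u => b u * (χ u).re * (φ x * (χ x).re)).symm.trans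
      ?_ |>.symm
    refine sum_congr rfl fun z _ => ?_
    simp only [Equiv.coe_addRight, re_char_add h2]
    rcases re_char_eq_one_or_neg_one h2 χ x with hx | hx <;> rw [hx] <;> ring
  have hsq : N * ∑ z, h z ^ 2 ≤ (ε * N) ^ 2 * (N * N) := by
    rw [hNdef, ← sum_sq_sum_mul_re_char h2 h, ← hNdef]
    calc ∑ χ : AddChar G ℂ, (∑ z, h z * (χ z).re) ^ 2
        ≤ ∑ χ : AddChar G ℂ, (ε * N) ^ 2 * (∑ x, φ x * (χ x).re) ^ 2 := by
          refine sum_le_sum fun χ _ => ?_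
          rw [hhhat, mul_pow]
          refine mul_le_mul_of_nonneg_right ?_ (sq_nonneg _)
          rw [← sq_abs]
          exact pow_le_pow_left₀ (abs_nonneg _) (hbhat χ) 2
      _ = (ε * N) ^ 2 * (N * ∑ x, φ x ^ 2) := by
          rw [← mul_sum, sum_sq_sum_mul_re_char h2 φ]
      _ ≤ (ε * N) ^ 2 * (N * N) := by
          have : ∑ x, φ x ^ 2 ≤ N := by
            calc ∑ x, φ x ^ 2 ≤ ∑ _x : G, (1 : ℝ) :=
                  sum_le_sum fun x _ => by
                    rw [← sq_abs]; exact pow_le_one₀ (abs_nonneg _) (hφ x)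
              _ = N := by simp [hNdef]
          gcongr
  have hsq' : ∑ z, h z ^ 2 ≤ (ε * N) ^ 2 * N :=
    le_of_mul_le_mul_left (by linarith) hN
  have hcs : (∑ z, |h z|) ^ 2 ≤ (ε * N ^ 2) ^ 2 := by
    calc (∑ z, |h z|) ^ 2 ≤ N * ∑ z, |h z| ^ 2 := by
          simpa [hNdef] using sq_sum_le_card_mul_sum_sq (s := (univ : Finset G)) (f := fun z => |h z|)
      _ ≤ N * ((ε * N) ^ 2 * N) := by
          simp only [sq_abs]
          gcongr
      _ = (ε * N ^ 2) ^ 2 := by ring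
  exact (le_abs_self _).trans (abs_le_of_sq_le_sq hcs (by positivity))

/-! ### Counting corners by Cauchy–Schwarz -/

/-- Cauchy–Schwarz in `(z, x)` removes the factor `b x (z + x)`. Its support condition is kept as `t
(z + x)`, which carries the information that makes uniformity of `T` usable afterwards. -/
theorem sq_sum_corner_le {G : Type*} [AddCommGroup G] [Fintype G] {t : G → ℝ} {f b : G → G → ℝ}
    (ht : ∀ x, t x * t x = t x) (hb : ∀ x y, b x y * b x y = b x y)
    (hbt : ∀ x y, b x y * t y = b x y) :
    (∑ z, ∑ x, ∑ y, f x y * b x (z + x) * b (z + y) y) ^ 2 ≤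
      (∑ x, ∑ y, b x y) * ∑ y, ∑ y', ∑ z, b (z + y) y * b (z + y') y' *
        ∑ x, t (z + x) * (f x y * f x y') := by
  set F : G → G → ℝ := fun z x => ∑ y, f x y * b (z + y) y with hF
  have h1 : ∑ z, ∑ x, ∑ y, f x y * b x (z + x) * b (z + y) y =
      ∑ p : G × G, b p.2 (p.1 + p.2) * (t (p.1 + p.2) * F p.1 p.2) := by
    rw [Fintype.sum_prod_type]
    refine sum_congr rfl fun z _ => sum_congr rfl fun x _ => ?_
    rw [← mul_assoc, hbt, hF, mul_sum]
    exact sum_congr rfl fun y _ => by ring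
  have h2 : ∑ p : G × G, b p.2 (p.1 + p.2) ^ 2 = ∑ x, ∑ y, b x y := by
    rw [Fintype.sum_prod_type, sum_comm]
    refine sum_congr rfl fun x _ => ?_
    simp only [sq, hb]
    exact Equiv.sum_comp (Equiv.addRight x) fun u => b x u
  have h3 : ∑ p : G × G, (t (p.1 + p.2) * F p.1 p.2) ^ 2 =
      ∑ y, ∑ y', ∑ z, b (z + y) y * b (z + y') y' *
        ∑ x, t (z + x) * (f x y * f x y') := by
    rw [Fintype.sum_prod_type]
    have : ∀ z x, (t (z + x) * F z x) ^ 2 =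
        ∑ y, ∑ y', b (z + y) y * b (z + y') y' * (t (z + x) * (f x y * f x y')) := by
      intro z x
      rw [mul_pow, sq, ht, sq, hF, sum_mul_sum, mul_sum]
      refine sum_congr rfl fun y _ => ?_
      rw [mul_sum]
      exact sum_congr rfl fun y' _ => by ring
    simp only [this, mul_sum]
    calc ∑ z, ∑ x, ∑ y, ∑ y', b (z + y) y * b (z + y') y' * (t (z + x) * (f x y * f x y'))
        = ∑ z, ∑ y, ∑ y', ∑ x, b (z + y) y * b (z + y') y' *
            (t (z + x) * (f x y * f x y')) := by
          refine sum_congr rfl fun z _ => ?_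
          rw [sum_comm]
          exact sum_congr rfl fun y _ => sum_comm
      _ = _ := by
          rw [sum_comm]
          exact sum_congr rfl fun y _ => sum_comm
  rw [h1, ← h2, ← h3]
  exact sum_mul_sq_le_sq_mul_sq _ _ _

theorem sum_diagonal_eq {G : Type*} [AddCommGroup G] [Fintype G] (h2 : ∀ x : G, x + x = 0)
    (b : G → G → ℝ) (z : G) : ∑ x, b x (z + x) = ∑ y, b (z + y) y := by
  refine (Equiv.sum_comp (Equiv.addLeft z) fun x => b x (z + x)).symm.trans ?_
  refine sum_congr rfl fun y _ => ?_
  simp [← add_assoc, h2]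

/-- The correlation property of pseudorandom sets provided by Fourier uniformity. -/
def ShiftUniform {G : Type*} [AddCommGroup G] [Fintype G] (S : Finset G) (ε : ℝ) : Prop :=
  ∀ φ : G → ℝ, (∀ x, |φ x| ≤ 1) →
    ∑ z, |∑ x, (indR S (z + x) - #S / Fintype.card G) * φ x| ≤ ε * (Fintype.card G : ℝ) ^ 2

/-- For fixed `y, y'` the inner sum correlates a shift of `T` with a bounded function, so `indR T`
may be replaced by its density. The weights in `z` lie in `[0, 1]`, hence the error is at most the
sum of absolute values controlled by `ShiftUniform`. -/
theorem sum_codegree_lower {G : Type*} [AddCommGroup G] [Fintype G]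
    {T : Finset G} {f b : G → G → ℝ} {ε : ℝ} (hf : ∀ x y, |f x y| ≤ 1)
    (hb0 : ∀ x y, 0 ≤ b x y) (hb1 : ∀ x y, b x y ≤ 1) (hT : ShiftUniform T ε) :
    ∑ y, ∑ y', ∑ z, b (z + y) y * b (z + y') y' * ∑ x, indR T (z + x) * (f x y * f x y') ≤
      #T / Fintype.card G *
        (∑ y, ∑ y', (∑ z, b (z + y) y * b (z + y') y') * ∑ x, f x y * f x y') +
        ε * (Fintype.card G : ℝ) ^ 4 := by
  set N : ℝ := (Fintype.card G : ℝ) with hN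
  have key : ∀ y y', ∑ z, b (z + y) y * b (z + y') y' * ∑ x, indR T (z + x) * (f x y * f x y') ≤
      #T / N * ((∑ z, b (z + y) y * b (z + y') y') * ∑ x, f x y * f x y') + ε * N ^ 2 := by
    intro y y'
    have hφ : ∀ x, |f x y * f x y'| ≤ 1 := fun x => by
      rw [abs_mul]; exact mul_le_one₀ (hf _ _) (abs_nonneg _) (hf _ _)
    refine le_trans ?_ (add_le_add_right (hT _ hφ) _)
    rw [sum_mul, mul_sum, ← sum_add_distrib]
    refine sum_le_sum fun z _ => ?_
    have hw0 : 0 ≤ b (z + y) y * b (z + y') y' := mul_nonneg (hb0 _ _) (hb0 _ _)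
    have hw1 : b (z + y) y * b (z + y') y' ≤ 1 := mul_le_one₀ (hb1 _ _) (hb0 _ _) (hb1 _ _)
    have hx : ∑ x, indR T (z + x) * (f x y * f x y') = #T / N * ∑ x, f x y * f x y' +
        ∑ x, (indR T (z + x) - #T / N) * (f x y * f x y') := by
      rw [mul_sum, ← sum_add_distrib]
      exact sum_congr rfl fun x _ => by ring
    rw [hx]
    set E := ∑ x, (indR T (z + x) - #T / N) * (f x y * f x y')
    have : b (z + y) y * b (z + y') y' * E ≤ |E| := by
      refine (le_abs_self _).trans ?_
      rw [abs_mul, abs_of_nonneg hw0]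
      exact mul_le_of_le_one_left (abs_nonneg _) hw1
    linarith
  calc _ ≤ ∑ y, ∑ y', (#T / N * ((∑ z, b (z + y) y * b (z + y') y') * ∑ x, f x y * f x y')
        + ε * N ^ 2) := sum_le_sum fun y _ => sum_le_sum fun y' _ => key y y'
    _ = _ := by
      simp only [sum_add_distrib, ← mul_sum, sum_const, card_univ, nsmul_eq_mul, ← hN]
      ring

/-- The weight of a pair is at most the autocorrelation of `S` at `p.1 + p.2`, which uniformity
keeps near `#S ^ 2 / N` on average. Thus no small set of pairs can carry much weight. -/
theorem sum_weight_le {G : Type*} [AddCommGroup G] [Fintype G] [DecidableEq G]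
    (h2 : ∀ x : G, x + x = 0)
    {S : Finset G} {b : G → G → ℝ} {ε : ℝ}
    (hb0 : ∀ x y, 0 ≤ b x y) (hbS : ∀ x y, b x y ≤ indR S x) (hS : ShiftUniform S ε)
    (P : Finset (G × G)) :
    ∑ p ∈ P, ∑ z, b (z + p.1) p.1 * b (z + p.2) p.2 ≤
      (#S : ℝ) ^ 2 / Fintype.card G * #P + ε * (Fintype.card G : ℝ) ^ 3 := by
  set N : ℝ := (Fintype.card G : ℝ) with hN
  set E : G → ℝ := fun u => |∑ x, (indR S (u + x) - #S / N) * indR S x| with hE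
  have key : ∀ p : G × G, ∑ z, b (z + p.1) p.1 * b (z + p.2) p.2 ≤
      (#S : ℝ) ^ 2 / N + E (p.1 + p.2) := by
    intro p
    calc ∑ z, b (z + p.1) p.1 * b (z + p.2) p.2
        ≤ ∑ z, indR S (z + p.1) * indR S (z + p.2) :=
          sum_le_sum fun z _ => mul_le_mul (hbS _ _) (hbS _ _) (hb0 _ _) (indR_nonneg _ _)
      _ = ∑ x, indR S (p.1 + p.2 + x) * indR S x := by
          refine (Equiv.sum_comp (Equiv.addRight p.2)
            fun x => indR S (p.1 + p.2 + x) * indR S x).symm.trans ?_ |>.symm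
          refine sum_congr rfl fun z _ => ?_
          have : p.1 + p.2 + (z + p.2) = z + p.1 + (p.2 + p.2) := by abel
          simp [this, h2]
      _ = (#S : ℝ) ^ 2 / N + ∑ x, (indR S (p.1 + p.2 + x) - #S / N) * indR S x := by
          simp only [sub_mul, sum_sub_distrib, ← mul_sum, sum_indR]
          ring
      _ ≤ _ := by
          gcongr
          exact le_abs_self _
  calc _ ≤ ∑ p ∈ P, ((#S : ℝ) ^ 2 / N + E (p.1 + p.2)) := sum_le_sum fun p _ => key p
    _ ≤ (#S : ℝ) ^ 2 / N * #P + ∑ p : G × G, E (p.1 + p.2) := by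
        rw [sum_add_distrib, sum_const, nsmul_eq_mul, mul_comm]
        gcongr
        exact subset_univ _
    _ = (#S : ℝ) ^ 2 / N * #P + N * ∑ u, E u := by
        rw [Fintype.sum_prod_type]
        have : ∀ x, ∑ y, E (x + y) = ∑ u, E u := fun x => Equiv.sum_comp (Equiv.addLeft x) E
        simp [this, hN]
    _ ≤ _ := by
        have h := hS (indR S) fun x => by
          rw [abs_of_nonneg (indR_nonneg _ _)]; exact indR_le_one _ _
        have : N * ∑ u, E u ≤ N * (ε * N ^ 2) := by gcongr
        linarith [this]

theorem correlated_pairs_arith {δ ε s t N g X Y p : ℝ} (hδ : 0 < δ) (hs0 : 0 < s) (ht0 : 0 < t)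
    (hsN : s ≤ N) (htN : t ≤ N) (hg : δ ^ 2 * s ^ 2 * t ^ 2 / (4 * N) ≤ g)
    (e1 : (δ / 4 * g) ^ 2 ≤ δ * s * t * (t / N * X + ε * N ^ 4))
    (e2 : X ≤ δ ^ 3 * s / 256 * g + s * Y) (e3 : Y ≤ s ^ 2 / N * p + ε * N ^ 3)
    (hε : ε ≤ δ ^ 5 * s ^ 3 * t ^ 3 / (2048 * N ^ 6)) : δ ^ 5 * t ^ 2 / 2048 ≤ p := by
  have hN0 : 0 < N := hs0.trans_le hsN
  set h : ℝ := δ ^ 2 * s ^ 2 * t ^ 2 / (4 * N) with hh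
  have hh0 : 0 < h := by positivity
  have hg0 : 0 < g := hh0.trans_le hg
  -- `η` is scaled so that `2 * η` equals the contribution `δ * h ^ 2 / (64 * s * t)` of the
  -- guaranteed lower bound `h` for `g`; the main term then absorbs both uniformity errors.
  set η : ℝ := δ ^ 5 * s ^ 3 * t ^ 3 / (2048 * N ^ 2) with hη
  have hη4 : ε * N ^ 4 ≤ η := by
    calc ε * N ^ 4 ≤ δ ^ 5 * s ^ 3 * t ^ 3 / (2048 * N ^ 6) * N ^ 4 := by gcongr
      _ = η := by rw [hη]; field_simp
  have i1 : δ * g ^ 2 / (16 * s * t) - η ≤ t / N * X := by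
    have : (δ / 4 * g) ^ 2 / (δ * s * t) ≤ t / N * X + ε * N ^ 4 := by
      rw [div_le_iff₀ (by positivity)]; linarith
    have e : (δ / 4 * g) ^ 2 / (δ * s * t) = δ * g ^ 2 / (16 * s * t) := by
      field_simp; ring
    linarith
  have hY : Y ≤ s ^ 2 / N * p + η / N := by
    have : ε * N ^ 3 ≤ η / N := by
      rw [le_div_iff₀ hN0]; linarith
    linarith
  have i2 : t / N * X ≤ δ * g ^ 2 / (64 * s * t) + (t * s ^ 3 / N ^ 2 * p + η) := by
    have a1 : t / N * X ≤ t / N * (δ ^ 3 * s / 256 * g + s * (s ^ 2 / N * p + η / N)) := by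
      gcongr
      refine e2.trans ?_
      gcongr
    have a2 : t / N * (δ ^ 3 * s / 256 * g) = δ * g / (64 * s * t) * h := by
      rw [hh]; field_simp; ring
    have a3 : δ * g / (64 * s * t) * h ≤ δ * g / (64 * s * t) * g := by gcongr
    have a4 : t / N * (s * (η / N)) ≤ η := by
      have : t / N * (s * (η / N)) = (t / N) * (s / N) * η := by ring
      rw [this]
      have : (t / N) * (s / N) ≤ 1 :=
        mul_le_one₀ ((div_le_one hN0).mpr htN) (by positivity) ((div_le_one hN0).mpr hsN)
      exact mul_le_of_le_one_left (by positivity) this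
    have a5 : t / N * (s * (s ^ 2 / N * p)) = t * s ^ 3 / N ^ 2 * p := by field_simp
    have a6 : δ * g / (64 * s * t) * g = δ * g ^ 2 / (64 * s * t) := by ring
    have a7 : t / N * (δ ^ 3 * s / 256 * g + s * (s ^ 2 / N * p + η / N)) =
      t / N * (δ ^ 3 * s / 256 * g) + t / N * (s * (s ^ 2 / N * p)) +
        t / N * (s * (η / N)) := by ring
    linarith
  have i3 : δ * h ^ 2 / (64 * s * t) ≤ δ * g ^ 2 / (64 * s * t) := by gcongr
  have i4 : δ * h ^ 2 / (64 * s * t) = 2 * η := by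
    rw [hh, hη]; field_simp; ring
  have i5 : δ * g ^ 2 / (16 * s * t) = 4 * (δ * g ^ 2 / (64 * s * t)) := by
    field_simp; ring
  have i6 : η ≤ t * s ^ 3 / N ^ 2 * p := by linarith [(by positivity : 0 < η)]
  have i7 : η = t * s ^ 3 / N ^ 2 * (δ ^ 5 * t ^ 2 / 2048) := by
    rw [hη]; field_simp
  rw [i7] at i6
  exact le_of_mul_le_mul_left i6 (by positivity)

/-- If the weighted count of corners is large in absolute value, then many pairs of columns have
large correlation. -/
theorem card_correlated_pairs {G : Type*} [AddCommGroup G] [Fintype G] [DecidableEq G]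
    (h2 : ∀ x : G, x + x = 0) {S T V : Finset G} {f b : G → G → ℝ} {δ ε : ℝ} (hδ : 0 < δ)
    (hS : ShiftUniform S ε) (hT : ShiftUniform T ε) (hS0 : S.Nonempty) (hT0 : T.Nonempty)
    (hf : ∀ x y, |f x y| ≤ indR S x)
    (hbb : ∀ x y, b x y * b x y = b x y) (hb0 : ∀ x y, 0 ≤ b x y)
    (hbS : ∀ x y, b x y ≤ indR S x) (hbV : ∀ x y, b x y ≤ indR V y) (hVT : V ⊆ T)
    (hbδ : ∑ x, ∑ y, b x y ≤ δ * #S * #T)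
    (hg : δ ^ 2 * (#S : ℝ) ^ 2 * (#T : ℝ) ^ 2 / (4 * Fintype.card G) ≤
      ∑ z, (∑ y, b (z + y) y) ^ 2)
    (hΛ : (δ / 4 * ∑ z, (∑ y, b (z + y) y) ^ 2) ^ 2 ≤
      (∑ z, ∑ x, ∑ y, f x y * b x (z + x) * b (z + y) y) ^ 2)
    (hε : ε ≤ δ ^ 5 * (#S : ℝ) ^ 3 * (#T : ℝ) ^ 3 / (2048 * (Fintype.card G : ℝ) ^ 6)) :
    δ ^ 5 * (#T : ℝ) ^ 2 / 2048 ≤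
      #{p ∈ V ×ˢ V | δ ^ 3 * #S / 256 < ∑ x, f x p.1 * f x p.2} := by
  have hb1 : ∀ x y, b x y ≤ 1 := fun x y => (hbS x y).trans (indR_le_one _ _)
  have hf1 : ∀ x y, |f x y| ≤ 1 := fun x y => (hf x y).trans (indR_le_one _ _)
  have hbT : ∀ x y, b x y * indR T y = b x y := by
    intro x y
    by_cases hy : y ∈ T
    · simp [indR_of_mem hy]
    · have : b x y = 0 := le_antisymm
        ((hbV x y).trans (indR_of_notMem fun h => hy (hVT h)).le) (hb0 x y)
      simp [this]
  have hA := sq_sum_corner_le (f := f) (indR_mul_self T) hbb hbT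
  have hB := sum_codegree_lower hf1 hb0 hb1 hT
  set P := {p ∈ V ×ˢ V | δ ^ 3 * #S / 256 < ∑ x, f x p.1 * f x p.2} with hP
  have hC := sum_weight_le h2 hb0 hbS hS P
  set N : ℝ := (Fintype.card G : ℝ) with hN
  set g : ℝ := ∑ z, (∑ y, b (z + y) y) ^ 2 with hgdef
  set W : G → G → ℝ := fun y y' => ∑ z, b (z + y) y * b (z + y') y' with hW
  have hW0 : ∀ y y', 0 ≤ W y y' := fun y y' =>
    sum_nonneg fun z _ => mul_nonneg (hb0 _ _) (hb0 _ _)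
  set s : ℝ := (#S : ℝ) with hs
  set t : ℝ := (#T : ℝ) with ht
  have hs0 : 0 < s := by rw [hs]; exact_mod_cast hS0.card_pos
  have ht0 : 0 < t := by rw [ht]; exact_mod_cast hT0.card_pos
  have hsN : s ≤ N := by rw [hs, hN]; exact_mod_cast card_le_univ S
  have htN : t ≤ N := by rw [ht, hN]; exact_mod_cast card_le_univ T
  have hN0 : 0 < N := hs0.trans_le hsN
  have hWsum : ∑ p : G × G, W p.1 p.2 = g := by
    rw [Fintype.sum_prod_type]
    simp only [hW, hgdef, sq, sum_mul_sum]
    calc ∑ y, ∑ y', ∑ z, b (z + y) y * b (z + y') y'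
        = ∑ y, ∑ z, ∑ y', b (z + y) y * b (z + y') y' := sum_congr rfl fun y _ => sum_comm
      _ = _ := sum_comm
  -- Pairs outside `P` contribute at most the threshold times their weight, pairs in `P` at most `s`
  -- times theirs; the total weight is `g`.
  have hWff : ∑ p : G × G, W p.1 p.2 * ∑ x, f x p.1 * f x p.2 ≤
      δ ^ 3 * s / 256 * g + s * ∑ p ∈ P, W p.1 p.2 := by
    rw [← hWsum, mul_sum, mul_sum, ← sum_indR_mul P, ← sum_add_distrib]
    refine sum_le_sum fun p _ => ?_
    by_cases hp : p ∈ P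
    · rw [indR_of_mem hp, one_mul]
      have h1 : ∑ x, f x p.1 * f x p.2 ≤ s := by
        rw [hs, ← sum_indR]
        refine sum_le_sum fun x _ => (le_abs_self _).trans ?_
        rw [abs_mul]
        exact mul_le_of_le_one_right (abs_nonneg _) (hf1 _ _) |>.trans (hf _ _)
      have h2 := mul_le_mul_of_nonneg_left h1 (hW0 p.1 p.2)
      have h3 : 0 ≤ δ ^ 3 * s / 256 * W p.1 p.2 := mul_nonneg (by positivity) (hW0 _ _)
      linarith
    · rw [indR_of_notMem hp, zero_mul, add_zero]
      by_cases hpV : p ∈ V ×ˢ V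
      · have : ∑ x, f x p.1 * f x p.2 ≤ δ ^ 3 * s / 256 := by
          by_contra hlt
          exact hp (mem_filter.mpr ⟨hpV, not_le.mp hlt⟩)
        rw [mul_comm]
        exact mul_le_mul_of_nonneg_right this (hW0 _ _)
      · have hzero : W p.1 p.2 = 0 := by
          refine sum_eq_zero fun z _ => ?_
          rw [mem_product, not_and_or] at hpV
          rcases hpV with h | h
          · have : b (z + p.1) p.1 = 0 :=
              le_antisymm ((hbV _ _).trans (indR_of_notMem h).le) (hb0 _ _)
            simp [this]
          · have : b (z + p.2) p.2 = 0 :=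
              le_antisymm ((hbV _ _).trans (indR_of_notMem h).le) (hb0 _ _)
            simp [this]
        simp [hzero]
  rw [Fintype.sum_prod_type] at hWff
  set X : ℝ := ∑ y, ∑ y', W y y' * ∑ x, f x y * f x y' with hX
  set Y : ℝ := ∑ p ∈ P, W p.1 p.2 with hY
  have hg0 : 0 < g := lt_of_lt_of_le (by positivity) hg
  have e1 : (δ / 4 * g) ^ 2 ≤ δ * s * t * (t / N * X + ε * N ^ 4) := by
    refine hΛ.trans (hA.trans ?_)
    set Q := ∑ y, ∑ y', ∑ z, b (z + y) y * b (z + y') y' *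
        ∑ x, indR T (z + x) * (f x y * f x y') with hQ
    set B := ∑ x, ∑ y, b x y with hBdef
    have hB0 : 0 ≤ B := sum_nonneg fun x _ => sum_nonneg fun y _ => hb0 _ _
    have hBQ : 0 < B * Q := lt_of_lt_of_le (by positivity) (hΛ.trans hA)
    -- `Q` must be nonnegative before `B` can be replaced by its upper bound; this follows from
    -- positivity of `B * Q`.
    have hQ0 : 0 ≤ Q :=
      le_of_not_gt fun h => absurd hBQ (mul_nonpos_of_nonneg_of_nonpos hB0 h.le).not_gt
    exact mul_le_mul hbδ hB hQ0 (hB0.trans hbδ)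
  have e2 : X ≤ δ ^ 3 * s / 256 * g + s * Y := hWff
  have e3 : Y ≤ s ^ 2 / N * #P + ε * N ^ 3 := hC
  exact correlated_pairs_arith hδ hs0 ht0 hsN htN hg e1 e2 e3 hε

/-! ### The density increment -/

/-- If few values of `r` exceed their average `δ * s` noticeably, then most of the mass of `r` lies
on values close to the average. -/
theorem sum_filter_near_average {G : Type*} {T : Finset G} {r : G → ℝ} {δ c s : ℝ}
    (hδ : 0 < δ) (hδ1 : δ ≤ 1) (hc : 0 < c) (hc1 : c ≤ 1 / 8) (hs : 0 < s)
    (hrs : ∀ y, r y ≤ s) (hsum : ∑ y ∈ T, r y = δ * s * #T)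
    (htop : (#{y ∈ T | (δ + c * δ ^ 2) * s ≤ r y} : ℝ) ≤ c * δ ^ 2 * #T) :
    δ * s * #T / 2 ≤
      ∑ y ∈ T with r y < (δ + c * δ ^ 2) * s ∧ (δ - 8 * c * δ ^ 2) * s ≤ r y, r y := by
  classical
  set Top := {y ∈ T | (δ + c * δ ^ 2) * s ≤ r y} with hTop
  set Rest := {y ∈ T | ¬ (δ + c * δ ^ 2) * s ≤ r y} with hRest
  set Good := {y ∈ T | r y < (δ + c * δ ^ 2) * s ∧ (δ - 8 * c * δ ^ 2) * s ≤ r y} with hGood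
  set Low := {y ∈ Rest | ¬ (δ - 8 * c * δ ^ 2) * s ≤ r y} with hLow
  have hG : Good = {y ∈ Rest | (δ - 8 * c * δ ^ 2) * s ≤ r y} := by
    ext y
    simp only [hGood, hRest, mem_filter, not_le, and_assoc]
  have s1 : ∑ y ∈ Top, r y + ∑ y ∈ Rest, r y = ∑ y ∈ T, r y := sum_filter_add_sum_filter_not _ _ _
  have s2 : ∑ y ∈ Good, r y + ∑ y ∈ Low, r y = ∑ y ∈ Rest, r y := by
    rw [hG]; exact sum_filter_add_sum_filter_not _ _ _
  have c1 : (#Top : ℝ) + #Rest = #T := by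
    exact_mod_cast card_filter_add_card_filter_not (s := T) _
  have c2 : (#Good : ℝ) + #Low = #Rest := by
    rw [hG]; exact_mod_cast card_filter_add_card_filter_not (s := Rest) _
  have u1 : ∑ y ∈ Top, r y ≤ #Top * s := by
    simpa using sum_le_card_nsmul Top r s fun y _ => hrs y
  have u2 : ∑ y ∈ Low, r y ≤ #Low * ((δ - 8 * c * δ ^ 2) * s) := by
    simpa using sum_le_card_nsmul Low r ((δ - 8 * c * δ ^ 2) * s) fun y hy =>
      (not_le.mp (mem_filter.mp hy).2).le
  have u3 : ∑ y ∈ Good, r y ≤ #Good * ((δ + c * δ ^ 2) * s) := by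
    simpa using sum_le_card_nsmul Good r ((δ + c * δ ^ 2) * s) fun y hy =>
      (mem_filter.mp hy).2.1.le
  set p : ℝ := (#Top : ℝ)
  set l : ℝ := (#Low : ℝ)
  set m : ℝ := (#Good : ℝ)
  set t : ℝ := (#T : ℝ)
  have hp0 : 0 ≤ p := Nat.cast_nonneg _
  have hl0 : 0 ≤ l := Nat.cast_nonneg _
  have hm0 : 0 ≤ m := Nat.cast_nonneg _
  have ht0 : 0 ≤ t := Nat.cast_nonneg _
  have hcd : 0 < c * δ ^ 2 := by positivity
  -- Relative to `δ + c * δ ^ 2`, each low value falls short by at least `9 * c * δ ^ 2`. The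
  -- average being `δ`, this must be covered by the slack `c * δ ^ 2` over all of `T` and by the at
  -- most `c * δ ^ 2 * t` top values.
  have hl : 9 * (c * δ ^ 2) * l ≤ 2 * (c * δ ^ 2) * t := by
    have h : δ * t * s ≤ (p + l * (δ - 8 * c * δ ^ 2) + m * (δ + c * δ ^ 2)) * s := by linarith
    have h' := le_of_mul_le_mul_right h hs
    have h3 : 0 ≤ (δ + c * δ ^ 2) * p := by positivity
    have h4 : m = t - p - l := by linarith
    rw [h4] at h'
    linarith
  have hl' : l ≤ 2 / 9 * t := by
    have : (c * δ ^ 2) * (9 * l) ≤ (c * δ ^ 2) * (2 * t) := by linarith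
    linarith [le_of_mul_le_mul_left this hcd]
  have v1 : p * s ≤ 1 / 8 * (δ * s * t) := by
    have h1 : c * δ ^ 2 * t ≤ 1 / 8 * δ * t := by
      have : c * δ ^ 2 ≤ 1 / 8 * (δ * 1) := by
        rw [sq]; gcongr
      nlinarith
    calc p * s ≤ (1 / 8 * δ * t) * s := by gcongr; linarith
      _ = _ := by ring
  have v2 : l * ((δ - 8 * c * δ ^ 2) * s) ≤ 2 / 9 * (δ * s * t) := by
    calc l * ((δ - 8 * c * δ ^ 2) * s) ≤ l * (δ * s) := by
          gcongr; linarith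
      _ ≤ 2 / 9 * t * (δ * s) := by gcongr
      _ = _ := by ring
  have : 0 ≤ δ * s * t := by positivity
  linarith

/-- A nonzero term with `y ≠ z + x` would be a corner with difference `z + x + y`; only the `N ^ 2`
trivial triples remain. -/
theorem sum_corner_le_card_sq {G : Type*} [AddCommGroup G] [Fintype G] (h2 : ∀ x : G, x + x = 0)
    {A : Finset (G × G)} (hA : IsCornerFree (A : Set (G × G))) {b : G → G → ℝ}
    (hb0 : ∀ x y, 0 ≤ b x y) (hb : ∀ x y, b x y ≤ indR A (x, y)) :
    ∑ z, ∑ x, ∑ y, indR A (x, y) * b x (z + x) * b (z + y) y ≤ (Fintype.card G : ℝ) ^ 2 := by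
  classical
  have key : ∀ z x y, indR A (x, y) * b x (z + x) * b (z + y) y ≤
      if y = z + x then (1 : ℝ) else 0 := by
    intro z x y
    have hle : indR A (x, y) * b x (z + x) * b (z + y) y ≤
        indR A (x, y) * indR A (x, z + x) * indR A (z + y, y) :=
      mul_le_mul (mul_le_mul_of_nonneg_left (hb _ _) (indR_nonneg _ _)) (hb _ _) (hb0 _ _)
        (mul_nonneg (indR_nonneg _ _) (indR_nonneg _ _))
    refine hle.trans ?_
    split_ifs with hy
    · exact mul_le_one₀ (mul_le_one₀ (indR_le_one _ _) (indR_nonneg _ _) (indR_le_one _ _))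
        (indR_nonneg _ _) (indR_le_one _ _)
    · by_cases h1 : (x, y) ∈ A
      · by_cases h3 : (x, z + x) ∈ A
        · by_cases h4 : (z + y, y) ∈ A
          · exfalso
            refine (isCornerFree_iff_forall_add _).mp hA ⟨x, y, z + x + y, ?_, h1, ?_, ?_⟩
            · rw [Ne, add_eq_zero_iff_of_exponent_two h2]
              exact fun h => hy h.symm
            · have : x + (z + x + y) = z + y + (x + x) := by abel
              rw [this, h2, add_zero]
              exact h4
            · have : y + (z + x + y) = z + x + (y + y) := by abel
              rw [this, h2, add_zero]
              exact h3
          · simp [indR_of_notMem h4]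
        · simp [indR_of_notMem h3]
      · simp [indR_of_notMem h1]
  calc _ ≤ ∑ z : G, ∑ x : G, ∑ y : G, (if y = z + x then (1 : ℝ) else 0) :=
        sum_le_sum fun z _ => sum_le_sum fun x _ => sum_le_sum fun y _ => key z x y
    _ = _ := by simp [sq]

theorem card_inter_product {G : Type*} [Fintype G] [DecidableEq G]
    (A : Finset (G × G)) (S' T' : Finset G) :
    (#(A ∩ S' ×ˢ T') : ℝ) = ∑ y ∈ T', ∑ x ∈ S', indR A (x, y) := by
  rw [sum_comm, ← sum_product', inter_comm, ← filter_mem_eq_inter, card_filter]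
  push_cast
  exact sum_congr rfl fun p _ => by by_cases h : p ∈ A <;> simp [indR, h]

/-- Many correlated pairs of columns yield a rectangle on which `A` is denser. -/
theorem exists_rectangle_of_correlated_pairs {G : Type*} [Fintype G] [DecidableEq G]
    {S T V : Finset G} {A : Finset (G × G)} {δ : ℝ} (hδ : 0 < δ)
    (hS0 : S.Nonempty) (hT0 : T.Nonempty) (hAS : ∀ p ∈ A, p.1 ∈ S) (hVT : V ⊆ T)
    (hV1 : ∀ y ∈ V, δ / 2 * #S ≤ ∑ x, indR A (x, y))
    (hV2 : ∀ y ∈ V, ∑ x, indR A (x, y) ≤ 2 * δ * #S)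
    (hV3 : ∀ y ∈ V, (δ - 8 * (1 / 8192) * δ ^ 2) * #S ≤ ∑ x, indR A (x, y))
    (hP : δ ^ 5 * (#T : ℝ) ^ 2 / 2048 ≤
      #{p ∈ V ×ˢ V | δ ^ 3 * #S / 256 < ∑ x,
        (indR A (x, p.1) - (∑ x', indR A (x', p.1)) / #S * indR S x) *
        (indR A (x, p.2) - (∑ x', indR A (x', p.2)) / #S * indR S x)}) :
    ∃ S' T' : Finset G, S' ⊆ S ∧ T' ⊆ T ∧
      δ ^ 6 / 8192 * (#S * #T) ≤ (#S' * #T' : ℝ) ∧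
      (δ + δ ^ 2 / 8192) * (#S' * #T') ≤ #(A ∩ S' ×ˢ T') := by
  have hs0 : (0 : ℝ) < #S := by exact_mod_cast hS0.card_pos
  have ht0 : (0 : ℝ) < #T := by exact_mod_cast hT0.card_pos
  set r : G → ℝ := fun y => ∑ x, indR A (x, y) with hr
  have hr0 : ∀ y, 0 ≤ r y := fun y => sum_nonneg fun x _ => indR_nonneg _ _
  have haS' : ∀ x y, indR A (x, y) * indR S x = indR A (x, y) := by
    intro x y
    by_cases h : (x, y) ∈ A
    · rw [indR_of_mem (hAS _ h), mul_one]
    · rw [indR_of_notMem h, zero_mul]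
  set f : G → G → ℝ := fun x y => indR A (x, y) - r y / #S * indR S x with hf
  change _ ≤ (#{p ∈ V ×ˢ V | δ ^ 3 * #S / 256 < ∑ x, f x p.1 * f x p.2} : ℝ) at hP
  set P := {p ∈ V ×ˢ V | δ ^ 3 * #S / 256 < ∑ x, f x p.1 * f x p.2} with hPdef
  have hcardP : (#P : ℝ) = ∑ y ∈ V, (#{y' ∈ V | δ ^ 3 * #S / 256 < ∑ x, f x y * f x y'} : ℝ) := by
    rw [hPdef, card_filter, sum_product]
    push_cast
    exact sum_congr rfl fun y _ => by rw [card_filter]; push_cast; rfl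
  have hV0 : V.Nonempty := by
    rw [nonempty_iff_ne_empty]
    intro h
    have h0 : (#P : ℝ) = 0 := by rw [hcardP, h, sum_empty]
    rw [h0] at hP
    exact absurd hP (not_le.mpr (by positivity))
  obtain ⟨y, hyV, hy⟩ : ∃ y ∈ V, δ ^ 5 * #T / 2048 ≤
      (#{y' ∈ V | δ ^ 3 * #S / 256 < ∑ x, f x y * f x y'} : ℝ) := by
    refine exists_le_of_sum_le hV0 ?_
    rw [← hcardP, sum_const, nsmul_eq_mul]
    refine le_trans ?_ hP
    have : (#V : ℝ) ≤ #T := by exact_mod_cast card_le_card hVT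
    calc #V * (δ ^ 5 * #T / 2048) ≤ #T * (δ ^ 5 * #T / 2048) := by gcongr
      _ = _ := by ring
  set T' := {y' ∈ V | δ ^ 3 * #S / 256 < ∑ x, f x y * f x y'} with hT'
  set S' := {x ∈ S | (x, y) ∈ A} with hS'
  have hS'ind : ∀ x, indR S' x = indR A (x, y) := by
    intro x
    by_cases h : (x, y) ∈ A
    · rw [indR_of_mem h, indR_of_mem (mem_filter.mpr ⟨hAS _ h, h⟩)]
    · have h' : x ∉ S' := fun h' => h (mem_filter.mp h').2
      rw [indR_of_notMem h, indR_of_notMem h']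
  have hS'card : (#S' : ℝ) = r y := by
    rw [← sum_indR]
    exact sum_congr rfl fun x _ => hS'ind x
  refine ⟨S', T', filter_subset _ _, (filter_subset _ _).trans hVT, ?_, ?_⟩
  · rw [hS'card]
    have h1 : δ / 2 * #S ≤ r y := hV1 y hyV
    calc δ ^ 6 / 8192 * (#S * #T) ≤ (δ / 2 * #S) * (δ ^ 5 * #T / 2048) := by
          have : 0 < δ ^ 6 * (#S * #T) := by positivity
          linarith
      _ ≤ _ := mul_le_mul h1 hy (by positivity) (hr0 y)
  · rw [card_inter_product, hS'card]
    -- The codegree of columns `y, y'` exceeds `r y * r y' / #S` by `δ ^ 3 * #S / 256`. As `r y ≤ 2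
    -- * δ * #S`, this is a relative gain of `δ ^ 2 / 512`, twice the loss `8 * δ ^ 2 / 8192`
    -- allowed in `r y' / #S`.
    have key : ∀ y' ∈ T', (δ + δ ^ 2 / 8192) * r y ≤ ∑ x ∈ S', indR A (x, y') := by
      intro y' hy'
      have hff : ∑ x, f x y * f x y' = ∑ x ∈ S', indR A (x, y') - r y * (r y' / #S) := by
        have e : ∀ x, f x y * f x y' = indR S' x * indR A (x, y') -
            r y' / #S * indR A (x, y) - r y / #S * indR A (x, y') +
              r y / #S * (r y' / #S) * indR S x := by
          intro x
          rw [hS'ind]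
          have e1 := haS' x y
          have e2 := haS' x y'
          have e3 := indR_mul_self S x
          linear_combination (-(r y' / #S)) * e1 - r y / #S * e2 + r y / #S * (r y' / #S) * e3
        simp only [e, sum_add_distrib, sum_sub_distrib, ← mul_sum, sum_indR_mul, sum_indR]
        change _ - r y' / #S * r y - r y / #S * r y' + _ = _
        field_simp
        ring
      have h1 := (mem_filter.mp hy').2
      rw [hff] at h1
      have h3 : (δ - 8 * (1 / 8192) * δ ^ 2) ≤ r y' / #S := by
        rw [le_div_iff₀ hs0]
        exact hV3 y' (mem_filter.mp hy').1
      have h4 : r y * (δ - 8 * (1 / 8192) * δ ^ 2) ≤ r y * (r y' / #S) := by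
        gcongr
        exact hr0 y
      have h5 : δ ^ 2 * r y ≤ δ ^ 2 * (2 * δ * #S) := by
        gcongr
        exact hV2 y hyV
      have h6 : 0 ≤ δ ^ 2 * r y := mul_nonneg (by positivity) (hr0 y)
      linarith
    have := card_nsmul_le_sum T' _ _ key
    rw [nsmul_eq_mul] at this
    linarith

/-- Either many columns are noticeably dense, and they already give the rectangle, or most of `A`
lies on columns of nearly average density. In the second case the missing corners force correlated
columns. -/
theorem exists_density_increment {G : Type*} [AddCommGroup G] [Fintype G] [DecidableEq G]
    (h2 : ∀ x : G, x + x = 0) {S T : Finset G} {A : Finset (G × G)} (hAST : A ⊆ S ×ˢ T)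
    (hfree : IsCornerFree (A : Set (G × G))) {δ ε : ℝ} (hδ : 0 < δ)
    (hS0 : S.Nonempty) (hT0 : T.Nonempty) (hA : (#A : ℝ) = δ * #S * #T)
    (hS : ShiftUniform S ε) (hT : ShiftUniform T ε)
    (hε : ε ≤ δ ^ 5 * (#S : ℝ) ^ 3 * (#T : ℝ) ^ 3 / (2048 * (Fintype.card G : ℝ) ^ 6))
    (hN : 16 * (Fintype.card G : ℝ) ^ 3 ≤ δ ^ 3 * (#S : ℝ) ^ 2 * (#T : ℝ) ^ 2) :
    ∃ S' T' : Finset G, S' ⊆ S ∧ T' ⊆ T ∧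
      δ ^ 6 / 8192 * (#S * #T) ≤ (#S' * #T' : ℝ) ∧
      (δ + δ ^ 2 / 8192) * (#S' * #T') ≤ #(A ∩ S' ×ˢ T') := by
  have hs0 : (0 : ℝ) < #S := by exact_mod_cast hS0.card_pos
  have ht0 : (0 : ℝ) < #T := by exact_mod_cast hT0.card_pos
  have hδ1 : δ ≤ 1 := by
    have h : (#A : ℝ) ≤ #S * #T := by
      have := card_le_card hAST
      rw [card_product] at this
      exact_mod_cast this
    rw [hA, mul_assoc] at h
    exact (mul_le_iff_le_one_left (by positivity)).mp h
  set r : G → ℝ := fun y => ∑ x, indR A (x, y) with hr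
  have haS : ∀ x y, indR A (x, y) ≤ indR S x := by
    intro x y
    by_cases h : (x, y) ∈ A
    · rw [indR_of_mem (mem_product.mp (hAST h)).1]; exact indR_le_one _ _
    · rw [indR_of_notMem h]; exact indR_nonneg _ _
  have haS' : ∀ x y, indR A (x, y) * indR S x = indR A (x, y) := by
    intro x y
    by_cases h : (x, y) ∈ A
    · rw [indR_of_mem (mem_product.mp (hAST h)).1, mul_one]
    · rw [indR_of_notMem h, zero_mul]
  have hrS : ∀ y, r y = ∑ x ∈ S, indR A (x, y) := by
    intro y
    rw [← sum_indR_mul]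
    exact sum_congr rfl fun x _ => by rw [mul_comm, haS']
  have hr0 : ∀ y, 0 ≤ r y := fun y => sum_nonneg fun x _ => indR_nonneg _ _
  have hrs : ∀ y, r y ≤ #S := fun y => by
    rw [← sum_indR S]; exact sum_le_sum fun x _ => haS x y
  have hrsum : ∑ y ∈ T, r y = δ * #S * #T := by
    rw [← hA, ← inter_eq_left.mpr hAST, card_inter_product]
    exact sum_congr rfl fun y _ => hrS y
  set Top := {y ∈ T | (δ + 1 / 8192 * δ ^ 2) * #S ≤ r y} with hTop
  by_cases htop : (#Top : ℝ) ≤ 1 / 8192 * δ ^ 2 * #T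
  swap
  · refine ⟨S, Top, Subset.rfl, filter_subset _ _, ?_, ?_⟩
    · have : δ ^ 6 / 8192 ≤ 1 / 8192 * δ ^ 2 := by
        have := pow_le_pow_of_le_one hδ.le hδ1 (show 2 ≤ 6 by norm_num)
        linarith
      calc δ ^ 6 / 8192 * (#S * #T) ≤ 1 / 8192 * δ ^ 2 * (#S * #T) := by gcongr
        _ = #S * (1 / 8192 * δ ^ 2 * #T) := by ring
        _ ≤ #S * #Top := by gcongr; exact (not_le.mp htop).le
    · rw [card_inter_product]
      have := card_nsmul_le_sum Top (fun y => ∑ x ∈ S, indR A (x, y))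
        ((δ + 1 / 8192 * δ ^ 2) * #S) fun y hy => by
          simp only [← hrS]; exact (mem_filter.mp hy).2
      rw [nsmul_eq_mul] at this
      refine le_trans (le_of_eq ?_) this
      ring
  set V := {y ∈ T | r y < (δ + 1 / 8192 * δ ^ 2) * #S ∧
    (δ - 8 * (1 / 8192) * δ ^ 2) * #S ≤ r y} with hV
  have hVsum : δ * #S * #T / 2 ≤ ∑ y ∈ V, r y :=
    sum_filter_near_average hδ hδ1 (by norm_num) (by norm_num) hs0 hrs hrsum htop
  have hVT : V ⊆ T := filter_subset _ _
  have hVup : ∀ y ∈ V, r y ≤ 2 * δ * #S := by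
    intro y hy
    refine (mem_filter.mp hy).2.1.le.trans ?_
    gcongr
    nlinarith
  have hVlow : ∀ y ∈ V, δ / 2 ≤ r y / #S := by
    intro y hy
    rw [le_div_iff₀ hs0]
    refine le_trans ?_ (mem_filter.mp hy).2.2
    gcongr
    nlinarith
  -- `b` is `A` cut down to typical columns and `f` is `A` with its column means removed. Using
  -- column means instead of `δ` makes the codegrees of `f` exact differences of codegrees and
  -- products of densities.
  set b : G → G → ℝ := fun x y => indR A (x, y) * indR V y with hb
  set f : G → G → ℝ := fun x y => indR A (x, y) - r y / #S * indR S x with hf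
  have hb0 : ∀ x y, 0 ≤ b x y := fun x y => mul_nonneg (indR_nonneg _ _) (indR_nonneg _ _)
  have hbA : ∀ x y, b x y ≤ indR A (x, y) := fun x y =>
    mul_le_of_le_one_right (indR_nonneg _ _) (indR_le_one _ _)
  have hbb : ∀ x y, b x y * b x y = b x y := fun x y => by
    simp only [hb]
    rw [mul_mul_mul_comm, indR_mul_self, indR_mul_self]
  have hbS : ∀ x y, b x y ≤ indR S x := fun x y => (hbA x y).trans (haS x y)
  have hbS' : ∀ x y, indR S x * b x y = b x y := fun x y => by
    simp only [hb]
    rw [← mul_assoc, mul_comm (indR S x), haS']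
  have hbV : ∀ x y, b x y ≤ indR V y := fun x y =>
    mul_le_of_le_one_left (indR_nonneg _ _) (indR_le_one _ _)
  have hfS : ∀ x y, |f x y| ≤ indR S x := by
    intro x y
    have h0 : 0 ≤ r y / #S := div_nonneg (hr0 y) hs0.le
    have h1 : r y / #S ≤ 1 := (div_le_one hs0).mpr (hrs y)
    by_cases hx : x ∈ S
    · simp only [hf, indR_of_mem hx, mul_one]
      rw [abs_le]
      constructor <;> linarith [indR_nonneg A (x, y), indR_le_one A (x, y)]
    · have : indR A (x, y) = 0 :=
        le_antisymm ((haS x y).trans (indR_of_notMem hx).le) (indR_nonneg _ _)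
      simp [hf, indR_of_notMem hx, this]
  have hbsum : ∑ x, ∑ y, b x y = ∑ y ∈ V, r y := by
    rw [sum_comm, ← sum_indR_mul V]
    refine sum_congr rfl fun y _ => ?_
    rw [hr, mul_sum]
    exact sum_congr rfl fun x _ => mul_comm _ _
  have hbδ : ∑ x, ∑ y, b x y ≤ δ * #S * #T := by
    rw [hbsum, ← hrsum]
    exact sum_le_sum_of_subset_of_nonneg hVT fun y _ _ => hr0 y
  set N : ℝ := (Fintype.card G : ℝ) with hNdef
  have hN0 : 0 < N := by rw [hNdef]; exact_mod_cast Fintype.card_pos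
  set g : ℝ := ∑ z, (∑ y, b (z + y) y) ^ 2 with hg
  have hg1 : δ ^ 2 * (#S : ℝ) ^ 2 * (#T : ℝ) ^ 2 / (4 * N) ≤ g := by
    have h1 : (∑ z, ∑ y, b (z + y) y) ^ 2 ≤ N * g := by
      simpa [hNdef] using
        sq_sum_le_card_mul_sum_sq (s := (univ : Finset G)) (f := fun z => ∑ y, b (z + y) y)
    have h3 : ∑ z, ∑ y, b (z + y) y = ∑ y ∈ V, r y := by
      rw [← hbsum, sum_comm, sum_comm (f := fun x y => b x y)]
      exact sum_congr rfl fun y _ => Equiv.sum_comp (Equiv.addRight y) fun x => b x y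
    rw [h3] at h1
    have h4 : (δ * #S * #T / 2) ^ 2 ≤ N * g := le_trans (by gcongr) h1
    rw [div_le_iff₀ (by positivity)]
    linarith
  have hg0 : 0 < g := lt_of_lt_of_le (by positivity) hg1
  -- The trivial corners take up at most half of the main term `δ / 2 * g`.
  have hNg : N ^ 2 ≤ δ / 4 * g := by
    refine le_trans ?_ (mul_le_mul_of_nonneg_left hg1 (by positivity))
    rw [← mul_div_assoc, le_div_iff₀ (by positivity)]
    linarith
  have hΛ : ∑ z, ∑ x, ∑ y, f x y * b x (z + x) * b (z + y) y ≤ -(δ / 4 * g) := by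
    have h1 := sum_corner_le_card_sq h2 hfree hb0 hbA
    have h3 : ∑ z, ∑ x, ∑ y, f x y * b x (z + x) * b (z + y) y =
        ∑ z, ∑ x, ∑ y, indR A (x, y) * b x (z + x) * b (z + y) y -
        ∑ z, (∑ y, b (z + y) y) * ∑ y, r y / #S * b (z + y) y := by
      rw [← sum_sub_distrib]
      refine sum_congr rfl fun z _ => ?_
      rw [← sum_diagonal_eq h2, sum_mul_sum, ← sum_sub_distrib]
      refine sum_congr rfl fun x _ => ?_
      rw [← sum_sub_distrib]
      refine sum_congr rfl fun y _ => ?_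
      linear_combination (-(r y / #S * b (z + y) y)) * hbS' x (z + x)
    have h4 : δ / 2 * g ≤ ∑ z, (∑ y, b (z + y) y) * ∑ y, r y / #S * b (z + y) y := by
      rw [hg, mul_sum]
      refine sum_le_sum fun z _ => ?_
      have : δ / 2 * ∑ y, b (z + y) y ≤ ∑ y, r y / #S * b (z + y) y := by
        rw [mul_sum]
        refine sum_le_sum fun y _ => ?_
        by_cases hy : y ∈ V
        · exact mul_le_mul_of_nonneg_right (hVlow y hy) (hb0 _ _)
        · simp [hb, indR_of_notMem hy]
      calc δ / 2 * (∑ y, b (z + y) y) ^ 2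
          = (∑ y, b (z + y) y) * (δ / 2 * ∑ y, b (z + y) y) := by ring
        _ ≤ _ := mul_le_mul_of_nonneg_left this (sum_nonneg fun y _ => hb0 _ _)
    rw [h3]
    linarith
  have hP := card_correlated_pairs h2 hδ hS hT hS0 hT0 hfS hbb hb0 hbS hbV hVT hbδ hg1
    ((pow_le_pow_left₀ (by positivity) (le_neg.mpr hΛ) 2).trans_eq (neg_sq _)) hε
  refine exists_rectangle_of_correlated_pairs hδ hS0 hT0 (fun p hp => (mem_product.mp (hAST hp)).1)
    hVT (fun y hy => (le_div_iff₀ hs0).mp (hVlow y hy)) hVup (fun y hy => ?_) hP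
  exact (mem_filter.mp hy).2.2

/-! ### Cells, cosets of index-two subgroups and the energy increment -/

/-- A corner-free set `A ⊆ S × T` in the square of a finite group of exponent two. -/
structure CornerCell where
  carrier : Type
  [addCommGroup : AddCommGroup carrier]
  [fintype : Fintype carrier]
  add_self : ∀ x : carrier, x + x = 0
  S : Finset carrier
  T : Finset carrier
  A : Finset (carrier × carrier)
  mem_of_mem : ∀ p ∈ A, p.1 ∈ S ∧ p.2 ∈ T
  isCornerFree : IsCornerFree (A : Set (carrier × carrier))

namespace CornerCell

attribute [instance] CornerCell.addCommGroup CornerCell.fintype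

/-- The order of the group. -/
def N (c : CornerCell) : ℝ := (Fintype.card c.carrier : ℝ)

theorem N_pos (c : CornerCell) : 0 < c.N := by
  unfold N
  exact_mod_cast Fintype.card_pos

/-- The subgroup on which a character is trivial. -/
def kerChar {G : Type} [AddCommGroup G] (χ : AddChar G ℂ) : AddSubgroup G where
  carrier := {x | χ x = 1}
  zero_mem' := AddChar.map_zero_eq_one χ
  add_mem' := by
    intro x y hx hy
    simp only [Set.mem_ofPred_eq] at *
    rw [AddChar.map_add_eq_mul, hx, hy, one_mul]
  neg_mem' := by
    intro x hx
    simp only [Set.mem_ofPred_eq] at *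
    rw [AddChar.map_neg_eq_inv, hx, inv_one]

theorem mem_kerChar {G : Type} [AddCommGroup G] {χ : AddChar G ℂ} {x : G} :
    x ∈ kerChar χ ↔ χ x = 1 := Iff.rfl

theorem exists_char_eq_neg_one {G : Type} [AddCommGroup G] (h2 : ∀ x : G, x + x = 0)
    {χ : AddChar G ℂ} (hχ : χ ≠ 0) : ∃ g, χ g = -1 := by
  by_contra! h
  refine hχ (DFunLike.ext _ _ fun x => ?_)
  rw [AddChar.zero_apply]
  exact (char_eq_one_or_neg_one h2 χ x).resolve_right (h x)

open Classical in
theorem sum_eq_sum_kerChar_add {G : Type} [AddCommGroup G] [Fintype G]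
    (h2 : ∀ x : G, x + x = 0) {χ : AddChar G ℂ} {g : G} (hg : χ g = -1) (F : G → ℝ) :
    ∑ x, F x = ∑ k : kerChar χ, F (k + 0) + ∑ k : kerChar χ, F (k + g) := by
  have h1 : ∀ H : G → ℝ, ∑ k : kerChar χ, H k = ∑ x with χ x = 1, H x := fun H =>
    (sum_subtype _ (fun x => by simp [mem_kerChar]) H).symm
  have hshift : ∑ x with ¬ χ x = 1, F x = ∑ x with χ x = 1, F (x + g) := by
    rw [sum_filter, sum_filter]
    refine (Equiv.sum_comp (Equiv.addRight g) _).symm.trans (sum_congr rfl fun x _ => ?_)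
    simp only [Equiv.coe_addRight, AddChar.map_add_eq_mul, hg]
    rcases char_eq_one_or_neg_one h2 χ x with h | h <;> rw [h] <;> norm_num
  simp only [add_zero]
  rw [h1 F, h1 fun x => F (x + g), ← hshift, sum_filter_add_sum_filter_not]

open Classical in
/-- The part of a cell lying in a product of cosets of a subgroup. -/
noncomputable def restrict (c : CornerCell) (K : AddSubgroup c.carrier) [Fintype K]
    (i j : c.carrier) : CornerCell where
  carrier := K
  add_self x := Subtype.ext (c.add_self x)
  S := {k : K | (k : c.carrier) + i ∈ c.S}
  T := {k : K | (k : c.carrier) + j ∈ c.T}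
  A := {p : K × K | ((p.1 : c.carrier) + i, (p.2 : c.carrier) + j) ∈ c.A}
  mem_of_mem p hp := by
    simp only [mem_filter, mem_univ, true_and] at hp ⊢
    exact c.mem_of_mem _ hp
  isCornerFree := by
    rw [isCornerFree_iff_forall_add]
    rintro ⟨x, y, d, hd, h1, h2, h3⟩
    refine (isCornerFree_iff_forall_add _).mp c.isCornerFree
      ⟨x + i, y + j, d, fun h => hd (Subtype.ext h), ?_, ?_, ?_⟩
    · simpa using h1
    · have : (x : c.carrier) + i + d = x + d + i := by abel
      rw [this]
      simpa using h2
    · have : (y : c.carrier) + j + d = y + d + j := by abel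
      rw [this]
      simpa using h3

theorem N_restrict (c : CornerCell) (K : AddSubgroup c.carrier) [Fintype K] (i j : c.carrier) :
    (c.restrict K i j).N = ∑ _k : K, (1 : ℝ) := by
  simp only [N, sum_const, card_univ, nsmul_eq_mul, mul_one]
  rfl

theorem card_filter_eq_sum_indR {α β : Type*} [Fintype α] (U : Finset β) (φ : α → β)
    [DecidablePred fun k => φ k ∈ U] :
    (#{k : α | φ k ∈ U} : ℝ) = ∑ k, indR U (φ k) := by
  rw [card_filter]
  push_cast
  exact sum_congr rfl fun k _ => by by_cases h : φ k ∈ U <;> simp [indR, h]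

open Classical in
theorem card_S_restrict (c : CornerCell) (K : AddSubgroup c.carrier) [Fintype K]
    (i j : c.carrier) :
    (#(c.restrict K i j).S : ℝ) = ∑ k : K, indR c.S (k + i) :=
  card_filter_eq_sum_indR c.S fun k : K => (k : c.carrier) + i

open Classical in
theorem card_T_restrict (c : CornerCell) (K : AddSubgroup c.carrier) [Fintype K]
    (i j : c.carrier) :
    (#(c.restrict K i j).T : ℝ) = ∑ k : K, indR c.T (k + j) :=
  card_filter_eq_sum_indR c.T fun k : K => (k : c.carrier) + j

open Classical in
theorem card_A_restrict (c : CornerCell) (K : AddSubgroup c.carrier) [Fintype K]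
    (i j : c.carrier) :
    (#(c.restrict K i j).A : ℝ) =
      ∑ k : K, ∑ l : K, indR c.A ((k : c.carrier) + i, (l : c.carrier) + j) := by
  rw [← Fintype.sum_prod_type']
  exact card_filter_eq_sum_indR c.A fun p : K × K => ((p.1 : c.carrier) + i, (p.2 : c.carrier) + j)

/-- The surplus of `A` over density `δ`, plus `l` times the energy of `S` and `T`. -/
noncomputable def potential (c : CornerCell) (δ l : ℝ) : ℝ :=
  (#c.A - δ * (#c.S * #c.T) + l * ((#c.S : ℝ) ^ 2 + (#c.T : ℝ) ^ 2)) / c.N ^ 2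

-- By the parallelogram law, the potentials of the four coset products average exactly to the
-- left-hand side: surplus is additive, while the energy gains the squared Fourier coefficients.
-- Some cell is at least average.
open Classical in
theorem exists_restrict_potential_ge (c : CornerCell) {χ : AddChar c.carrier ℂ} (hχ : χ ≠ 0)
    (δ l : ℝ) :
    ∃ c' : CornerCell, c.N = 2 * c'.N ∧ c.potential δ l + l *
      ((∑ x ∈ c.S, (χ x).re) ^ 2 + (∑ x ∈ c.T, (χ x).re) ^ 2) / c.N ^ 2 ≤ c'.potential δ l := by
  obtain ⟨g, hg⟩ := exists_char_eq_neg_one c.add_self hχ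
  have hsplit := sum_eq_sum_kerChar_add c.add_self hg
  set K := kerChar χ with hK
  set n : ℝ := ∑ _k : K, (1 : ℝ) with hn
  have hN : c.N = 2 * n := by
    have := hsplit fun _ => 1
    simp only [sum_const, card_univ, nsmul_eq_mul, mul_one] at this
    simp only [N, hn, sum_const, card_univ, nsmul_eq_mul, mul_one]
    linarith
  have hn0 : 0 < n := by linarith [c.N_pos]
  have hchar : ∀ U : Finset c.carrier, ∑ x ∈ U, (χ x).re =
      ∑ k : K, indR U (k + 0) - ∑ k : K, indR U (k + g) := by
    intro U
    rw [← sum_indR_mul, hsplit, sub_eq_add_neg, ← sum_neg_distrib]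
    congr 1
    · refine sum_congr rfl fun k _ => ?_
      have : χ (k : c.carrier) = 1 := k.2
      simp [this]
    · refine sum_congr rfl fun k _ => ?_
      have : χ ((k : c.carrier) + g) = -1 := by
        rw [AddChar.map_add_eq_mul, hg, mem_kerChar.mp k.2, one_mul]
      simp [this]
  have hcard : ∀ U : Finset c.carrier, (#U : ℝ) =
      ∑ k : K, indR U (k + 0) + ∑ k : K, indR U (k + g) := by
    intro U
    rw [← sum_indR, hsplit]
  have hA : (#c.A : ℝ) = #(c.restrict K 0 0).A + #(c.restrict K 0 g).A +
      (#(c.restrict K g 0).A + #(c.restrict K g g).A) := by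
    simp only [card_A_restrict]
    rw [← sum_indR, Fintype.sum_prod_type, hsplit]
    simp only [fun x => hsplit fun y => indR c.A (x, y), sum_add_distrib]
  by_contra! hcon
  have hlt : ∀ i j, (c.restrict K i j).potential δ l < c.potential δ l + l *
      ((∑ x ∈ c.S, (χ x).re) ^ 2 + (∑ x ∈ c.T, (χ x).re) ^ 2) / c.N ^ 2 := fun i j =>
    hcon _ (by rw [hN, N_restrict])
  have e1 := hlt 0 0
  have e2 := hlt 0 g
  have e3 := hlt g 0
  have e4 := hlt g g
  unfold potential at e1 e2 e3 e4
  rw [← add_div] at e1 e2 e3 e4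
  simp only [N_restrict, card_S_restrict, card_T_restrict, hchar] at e1 e2 e3 e4
  rw [hcard c.S, hcard c.T, hA, hN, ← hn, div_lt_div_iff₀ (by positivity) (by positivity),
    mul_pow] at e1 e2 e3 e4
  have hn2 : 0 < n ^ 2 := by positivity
  generalize (∑ k : K, indR c.S (k + 0)) = s0 at *
  generalize (∑ k : K, indR c.S (k + g)) = s1 at *
  generalize (∑ k : K, indR c.T (k + 0)) = t0 at *
  generalize (∑ k : K, indR c.T (k + g)) = t1 at *
  linarith

end CornerCell

namespace CornerCell

theorem card_S_le (c : CornerCell) : (#c.S : ℝ) ≤ c.N := by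
  unfold N; exact_mod_cast card_le_univ _

theorem card_T_le (c : CornerCell) : (#c.T : ℝ) ≤ c.N := by
  unfold N; exact_mod_cast card_le_univ _

theorem card_A_le (c : CornerCell) : (#c.A : ℝ) ≤ #c.S * #c.T := by
  have h : c.A ⊆ c.S ×ˢ c.T := fun p hp => mem_product.mpr (c.mem_of_mem p hp)
  have := card_le_card h
  rw [card_product] at this
  exact_mod_cast this

/-- This ceiling bounds the number of halvings in `exists_uniform`, each of which gains at least `l
* ε ^ 2`. -/
theorem potential_le (c : CornerCell) {δ l : ℝ} (hδ : 0 ≤ δ) (hl : 0 ≤ l) :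
    c.potential δ l ≤ 1 + 2 * l := by
  have hN := c.N_pos
  have hs : (0 : ℝ) ≤ #c.S := Nat.cast_nonneg _
  have ht : (0 : ℝ) ≤ #c.T := Nat.cast_nonneg _
  have h1 : (#c.S : ℝ) * #c.T ≤ c.N * c.N := mul_le_mul c.card_S_le c.card_T_le ht hN.le
  have h2 : (#c.S : ℝ) ^ 2 ≤ c.N ^ 2 := pow_le_pow_left₀ hs c.card_S_le 2
  have h3 : (#c.T : ℝ) ^ 2 ≤ c.N ^ 2 := pow_le_pow_left₀ ht c.card_T_le 2
  have h4 : 0 ≤ δ * (#c.S * #c.T : ℝ) := by positivity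
  have h5 : l * ((#c.S : ℝ) ^ 2 + (#c.T : ℝ) ^ 2) ≤ l * (c.N ^ 2 + c.N ^ 2) := by gcongr
  unfold potential
  rw [div_le_iff₀ (by positivity)]
  linarith [c.card_A_le]

/-- Passing repeatedly to products of cosets of index-two subgroups, one reaches a cell with
uniform sides without decreasing the potential. -/
theorem exists_uniform {δ l ε : ℝ} (hδ : 0 ≤ δ) (hl : 0 < l) (hε : 0 < ε) (k : ℕ) :
    ∀ c : CornerCell, 1 + 2 * l - k * (l * ε ^ 2) < c.potential δ l →
      ∃ c' : CornerCell, FourierUniform c'.S ε ∧ FourierUniform c'.T ε ∧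
        c.potential δ l ≤ c'.potential δ l ∧ c.N ≤ 2 ^ k * c'.N := by
  induction k with
  | zero =>
    intro c hc
    have := c.potential_le hδ hl.le
    simp at hc
    linarith
  | succ k ih =>
    intro c hc
    have hN := c.N_pos
    by_cases hu : FourierUniform c.S ε ∧ FourierUniform c.T ε
    · refine ⟨c, hu.1, hu.2, le_rfl, ?_⟩
      exact le_mul_of_one_le_left hN.le (one_le_pow₀ one_le_two)
    · obtain ⟨χ, hχ, hbig⟩ : ∃ χ : AddChar c.carrier ℂ, χ ≠ 0 ∧
          (ε * c.N) ^ 2 ≤ (∑ x ∈ c.S, (χ x).re) ^ 2 + (∑ x ∈ c.T, (χ x).re) ^ 2 := by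
        have hbd : ∀ x : ℝ, ¬ |x| ≤ ε * c.N → (ε * c.N) ^ 2 ≤ x ^ 2 := fun x hx => by
          rw [← sq_abs x]
          exact pow_le_pow_left₀ (by positivity) (not_le.mp hx).le 2
        rw [not_and_or] at hu
        unfold FourierUniform at hu
        push Not at hu
        rcases hu with ⟨χ, hχ, h⟩ | ⟨χ, hχ, h⟩
        · exact ⟨χ, hχ, by linarith [hbd _ (not_le.mpr h), sq_nonneg (∑ x ∈ c.T, (χ x).re)]⟩
        · exact ⟨χ, hχ, by linarith [hbd _ (not_le.mpr h), sq_nonneg (∑ x ∈ c.S, (χ x).re)]⟩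
      obtain ⟨c', hN', hpot⟩ := c.exists_restrict_potential_ge hχ δ l
      have hgain : l * ε ^ 2 ≤ l *
          ((∑ x ∈ c.S, (χ x).re) ^ 2 + (∑ x ∈ c.T, (χ x).re) ^ 2) / c.N ^ 2 := by
        rw [le_div_iff₀ (by positivity)]
        calc l * ε ^ 2 * c.N ^ 2 = l * (ε * c.N) ^ 2 := by ring
          _ ≤ _ := by gcongr
      have hle : 0 < l * ε ^ 2 := by positivity
      push_cast at hc
      obtain ⟨d, h1, h2, h3, h4⟩ := ih c' (by linarith)
      refine ⟨d, h1, h2, by linarith, ?_⟩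
      rw [hN', pow_succ]
      linarith

/-! ### Iterating the density increment -/

/-- One step of the density increment strategy. -/
theorem exists_denser_uniform (c : CornerCell) {δ δ₀ μ ε : ℝ} {k : ℕ} (hδ₀ : 0 < δ₀) (hδ : δ₀ ≤ δ)
    (hμ : 0 < μ) (hε : 0 < ε) (hS : FourierUniform c.S ε) (hT : FourierUniform c.T ε)
    (hA : (#c.A : ℝ) = δ * (#c.S * #c.T)) (hμc : μ * c.N ^ 2 ≤ #c.S * #c.T)
    (hεμ : ε ≤ δ₀ ^ 5 * μ ^ 3 / 2048) (hN : 16 ≤ δ₀ ^ 3 * μ ^ 2 * c.N)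
    (hk : 4 ≤ k * (δ₀ ^ 8 / 2 ^ 28 * μ) * ε ^ 2) :
    ∃ (c' : CornerCell) (δ' : ℝ), FourierUniform c'.S ε ∧ FourierUniform c'.T ε ∧
      (#c'.A : ℝ) = δ' * (#c'.S * #c'.T) ∧ δ + δ ^ 2 / 16384 ≤ δ' ∧
      δ₀ ^ 8 / 2 ^ 28 * μ * c'.N ^ 2 ≤ #c'.S * #c'.T ∧ c.N ≤ 2 ^ k * c'.N := by
  classical
  have hN0 := c.N_pos
  have hδ0 : 0 < δ := hδ₀.trans_le hδ
  have hst : (0 : ℝ) < #c.S * #c.T := lt_of_lt_of_le (by positivity) hμc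
  have hS0 : c.S.Nonempty := by
    rw [nonempty_iff_ne_empty]; intro h; simp [h] at hst
  have hT0 : c.T.Nonempty := by
    rw [nonempty_iff_ne_empty]; intro h; simp [h] at hst
  have hst1 : (#c.S * #c.T : ℝ) ≤ c.N ^ 2 := by
    rw [sq]; exact mul_le_mul c.card_S_le c.card_T_le (Nat.cast_nonneg _) hN0.le
  have hμ1 : μ ≤ 1 := by
    have : μ * c.N ^ 2 ≤ 1 * c.N ^ 2 := by linarith
    exact le_of_mul_le_mul_right this (by positivity)
  have hδ1 : δ ≤ 1 := by
    have : δ * (#c.S * #c.T) ≤ 1 * (#c.S * #c.T) := by linarith [c.card_A_le]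
    exact le_of_mul_le_mul_right this hst
  have hδ₀1 : δ₀ ≤ 1 := hδ.trans hδ1
  obtain ⟨S', T', hS'S, hT'T, hsize, hdens⟩ := exists_density_increment c.add_self
    (fun p hp => mem_product.mpr (c.mem_of_mem p hp)) c.isCornerFree hδ0 hS0 hT0
    (by rw [hA]; ring) (fun φ => hS.sum_abs_le c.add_self hε.le φ)
    (fun φ => hT.sum_abs_le c.add_self hε.le φ)
    (by
      change ε ≤ δ ^ 5 * (#c.S : ℝ) ^ 3 * (#c.T : ℝ) ^ 3 / (2048 * c.N ^ 6)
      refine hεμ.trans ?_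
      rw [div_le_div_iff₀ (by norm_num) (by positivity)]
      calc δ₀ ^ 5 * μ ^ 3 * (2048 * c.N ^ 6) = δ₀ ^ 5 * (μ * c.N ^ 2) ^ 3 * 2048 := by ring
        _ ≤ δ ^ 5 * (#c.S * #c.T) ^ 3 * 2048 := by gcongr
        _ = _ := by ring)
    (by
      change 16 * c.N ^ 3 ≤ δ ^ 3 * (#c.S : ℝ) ^ 2 * (#c.T : ℝ) ^ 2
      calc 16 * c.N ^ 3 ≤ δ₀ ^ 3 * μ ^ 2 * c.N * c.N ^ 3 := by gcongr
        _ = δ₀ ^ 3 * (μ * c.N ^ 2) ^ 2 := by ring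
        _ ≤ δ ^ 3 * (#c.S * #c.T) ^ 2 := by gcongr
        _ = _ := by ring)
  let c₁ : CornerCell :=
    { carrier := c.carrier
      add_self := c.add_self
      S := S'
      T := T'
      A := c.A ∩ S' ×ˢ T'
      mem_of_mem := fun p hp => mem_product.mp (mem_inter.mp hp).2
      isCornerFree := c.isCornerFree.mono (by simp) }
  -- Aiming at half of the density gain leaves a surplus of `2 * q * N ^ 2`, since `2 ^ 14 * 2 ^ 13
  -- = 2 ^ 27`. With energy weight `q / 2` the energy term never exceeds `q * N ^ 2`, so a surplus
  -- of `q * N ^ 2` survives regularisation; it yields both the new density and the new lower bound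
  -- on `#d.S * #d.T`.
  set q : ℝ := δ₀ ^ 8 / 2 ^ 28 * μ with hq
  have hq0 : 0 < q := by positivity
  have hq1 : q ≤ 1 := by
    have : δ₀ ^ 8 ≤ 1 := pow_le_one₀ hδ₀.le hδ₀1
    calc q ≤ 1 / 2 ^ 28 * 1 := by rw [hq]; gcongr
      _ ≤ 1 := by norm_num
  have hδ2 : 0 ≤ δ + δ ^ 2 / 16384 := by positivity
  have hpot : 2 * q ≤ c₁.potential (δ + δ ^ 2 / 16384) (q / 2) := by
    have e : c₁.potential (δ + δ ^ 2 / 16384) (q / 2) =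
      (#(c.A ∩ S' ×ˢ T') - (δ + δ ^ 2 / 16384) * (#S' * #T') +
        q / 2 * ((#S' : ℝ) ^ 2 + (#T' : ℝ) ^ 2)) / c.N ^ 2 := rfl
    rw [e, le_div_iff₀ (by positivity)]
    have h1 : 2 * q * c.N ^ 2 ≤ δ ^ 2 / 16384 * (#S' * #T') := by
      calc 2 * q * c.N ^ 2 = δ₀ ^ 2 / 16384 * (δ₀ ^ 6 / 8192 * (μ * c.N ^ 2)) := by
            rw [hq]; ring
        _ ≤ δ ^ 2 / 16384 * (δ ^ 6 / 8192 * (#c.S * #c.T)) := by gcongr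
        _ ≤ _ := by gcongr
    have h2 : 0 ≤ q / 2 * ((#S' : ℝ) ^ 2 + (#T' : ℝ) ^ 2) := by positivity
    linarith
  obtain ⟨d, hdS, hdT, hdpot, hdN⟩ := exists_uniform hδ2 (half_pos hq0) hε k c₁ (by
    refine lt_of_lt_of_le ?_ hpot
    have : (k : ℝ) * (q / 2 * ε ^ 2) = k * q * ε ^ 2 / 2 := by ring
    rw [this]
    linarith)
  have hdN0 := d.N_pos
  have hd : q * d.N ^ 2 + (δ + δ ^ 2 / 16384) * (#d.S * #d.T) ≤ #d.A := by
    have h := hpot.trans hdpot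
    unfold potential at h
    rw [le_div_iff₀ (by positivity)] at h
    have h2 : (#d.S : ℝ) ^ 2 ≤ d.N ^ 2 := pow_le_pow_left₀ (Nat.cast_nonneg _) d.card_S_le 2
    have h3 : (#d.T : ℝ) ^ 2 ≤ d.N ^ 2 := pow_le_pow_left₀ (Nat.cast_nonneg _) d.card_T_le 2
    have h5 : q / 2 * ((#d.S : ℝ) ^ 2 + (#d.T : ℝ) ^ 2) ≤ q / 2 * (d.N ^ 2 + d.N ^ 2) := by gcongr
    linarith
  have hqd : 0 < q * d.N ^ 2 := by positivity
  have hdst0 : (0 : ℝ) ≤ (δ + δ ^ 2 / 16384) * (#d.S * #d.T) := by positivity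
  have hdst : (0 : ℝ) < #d.S * #d.T := by linarith [d.card_A_le]
  refine ⟨d, #d.A / (#d.S * #d.T), hdS, hdT, ?_, ?_, ?_, hdN⟩
  · exact (div_mul_cancel₀ _ hdst.ne').symm
  · rw [le_div_iff₀ hdst]; linarith
  · linarith [d.card_A_le]

theorem fourierUniform_univ {G : Type} [AddCommGroup G] [Fintype G] {ε : ℝ} (hε : 0 ≤ ε) :
    FourierUniform (univ : Finset G) ε := by
  intro χ hχ
  rw [sum_re_char_eq_zero hχ, abs_zero]
  positivity

/-- Tracking `1 / δ` makes the gain linear: an increment `c * δ ^ 2` becomes a decrease by `c / 2`,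
whatever `δ` is. -/
theorem one_div_add_sq_le {δ c : ℝ} (hδ : 0 < δ) (hδ1 : δ ≤ 1) (hc : 0 < c) (hc1 : c ≤ 1) :
    1 / (δ + c * δ ^ 2) ≤ 1 / δ - c / 2 := by
  rw [div_le_iff₀ (by positivity)]
  have : (1 / δ - c / 2) * (δ + c * δ ^ 2) = 1 + c * δ / 2 * (1 - c * δ) := by
    field_simp; ring
  rw [this]
  have : c * δ ≤ 1 := mul_le_one₀ hc1 hδ.le hδ1
  have : 0 ≤ c * δ / 2 * (1 - c * δ) := mul_nonneg (by positivity) (by linarith)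
  linarith

/-- A corner-free set in a large enough group of exponent two is sparse. -/
theorem card_lt_of_large {G : Type} [AddCommGroup G] [Fintype G] (h2 : ∀ x : G, x + x = 0)
    {A : Finset (G × G)} (hfree : IsCornerFree (A : Set (G × G))) {δ₀ m ε : ℝ} {K k : ℕ}
    (hδ₀ : 0 < δ₀) (hK : 32768 / δ₀ ≤ K) (hm : m = (δ₀ ^ 8 / 2 ^ 28) ^ K)
    (hε : ε = δ₀ ^ 5 * m ^ 3 / 2048) (hk : 4 ≤ k * m * ε ^ 2)
    (hN : 16 * 2 ^ (K * k) ≤ δ₀ ^ 3 * m ^ 2 * Fintype.card G) :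
    (#A : ℝ) < δ₀ * (Fintype.card G : ℝ) ^ 2 := by
  classical
  by_contra! hcon
  have hG0 : (0 : ℝ) < Fintype.card G := by exact_mod_cast Fintype.card_pos
  have hδ₀1 : δ₀ ≤ 1 := by
    have h : (#A : ℝ) ≤ (Fintype.card G : ℝ) ^ 2 := by
      have := card_le_univ A
      rw [Fintype.card_prod, ← sq] at this
      exact_mod_cast this
    have : δ₀ * (Fintype.card G : ℝ) ^ 2 ≤ 1 * (Fintype.card G : ℝ) ^ 2 := by linarith
    exact le_of_mul_le_mul_right this (by positivity)
  set q : ℝ := δ₀ ^ 8 / 2 ^ 28 with hq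
  have hq0 : 0 < q := by positivity
  have hq1 : q ≤ 1 := by
    have : δ₀ ^ 8 ≤ 1 := pow_le_one₀ hδ₀.le hδ₀1
    calc q ≤ 1 / 2 ^ 28 := by rw [hq]; gcongr
      _ ≤ 1 := by norm_num
  have hm0 : 0 < m := by rw [hm]; positivity
  have hε0 : 0 < ε := by rw [hε]; positivity
  -- The parameters `ε` and `k` are fixed once, for the smallest size `m = q ^ K`, and so serve
  -- every round.
  have hiter : ∀ i : ℕ, i ≤ K → ∃ (c : CornerCell) (δ : ℝ), δ₀ ≤ δ ∧ FourierUniform c.S ε ∧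
      FourierUniform c.T ε ∧ (#c.A : ℝ) = δ * (#c.S * #c.T) ∧ 1 / δ ≤ 1 / δ₀ - i / 32768 ∧
      q ^ i * c.N ^ 2 ≤ #c.S * #c.T ∧ (Fintype.card G : ℝ) ≤ 2 ^ (i * k) * c.N := by
    intro i
    induction i with
    | zero =>
      intro _
      refine ⟨{ carrier := G, add_self := h2, S := univ, T := univ, A := A,
                mem_of_mem := fun p _ => ⟨mem_univ _, mem_univ _⟩, isCornerFree := hfree },
        #A / (Fintype.card G : ℝ) ^ 2, ?_, fourierUniform_univ hε0.le, fourierUniform_univ hε0.le,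
        ?_, ?_, ?_, ?_⟩
      · rwa [le_div_iff₀ (by positivity)]
      · simp only [card_univ]
        field_simp
      · simp only [Nat.cast_zero, zero_div, sub_zero]
        refine one_div_le_one_div_of_le hδ₀ ?_
        rwa [le_div_iff₀ (by positivity)]
      · simp [N, sq]
      · simp [N]
    | succ i ih =>
      intro hi
      obtain ⟨c, δ, hδ, hS, hT, hA, hinv, hμ, hcN⟩ := ih (by omega)
      have hmi : m ≤ q ^ i := by
        rw [hm]; exact pow_le_pow_of_le_one hq0.le hq1 (by omega)
      have hmi' : m ≤ q * q ^ i := by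
        rw [hm, ← pow_succ']; exact pow_le_pow_of_le_one hq0.le hq1 hi
      have hδ0 : 0 < δ := hδ₀.trans_le hδ
      have hst : (0 : ℝ) < #c.S * #c.T :=
        lt_of_lt_of_le (mul_pos (pow_pos hq0 i) (pow_pos c.N_pos 2)) hμ
      have hδ1 : δ ≤ 1 := by
        have : δ * (#c.S * #c.T) ≤ 1 * (#c.S * #c.T) := by linarith [c.card_A_le]
        exact le_of_mul_le_mul_right this hst
      have hNc : 16 ≤ δ₀ ^ 3 * m ^ 2 * c.N := by
        have h1 : (2 : ℝ) ^ (i * k) ≤ 2 ^ (K * k) :=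
          pow_le_pow_right₀ one_le_two (Nat.mul_le_mul_right k (by omega))
        have h3 : 16 * (2 : ℝ) ^ (i * k) ≤ δ₀ ^ 3 * m ^ 2 * c.N * 2 ^ (i * k) := by
          calc 16 * (2 : ℝ) ^ (i * k) ≤ 16 * 2 ^ (K * k) := by gcongr
            _ ≤ δ₀ ^ 3 * m ^ 2 * Fintype.card G := hN
            _ ≤ δ₀ ^ 3 * m ^ 2 * (2 ^ (i * k) * c.N) := by gcongr
            _ = _ := by ring
        exact le_of_mul_le_mul_right h3 (by positivity)
      have hcN0 := c.N_pos
      obtain ⟨c', δ', h1, h3, h4, h5, h6, h7⟩ := c.exists_denser_uniform (k := k) hδ₀ hδ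
        (pow_pos hq0 i) hε0 hS hT hA hμ
        (by rw [hε]; gcongr) (hNc.trans (by gcongr)) (hk.trans (by gcongr))
      have hδ' : δ + 1 / 16384 * δ ^ 2 ≤ δ' := by linarith
      refine ⟨c', δ', ?_, h1, h3, h4, ?_, ?_, ?_⟩
      · have : 0 ≤ δ ^ 2 / 16384 := by positivity
        linarith
      · have e1 := one_div_add_sq_le hδ0 hδ1 (show (0 : ℝ) < 1 / 16384 by norm_num) (by norm_num)
        have e2 : 1 / δ' ≤ 1 / (δ + 1 / 16384 * δ ^ 2) :=
          one_div_le_one_div_of_le (by positivity) hδ'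
        push_cast
        linarith
      · rw [pow_succ']; exact h6
      · calc (Fintype.card G : ℝ) ≤ 2 ^ (i * k) * c.N := hcN
          _ ≤ 2 ^ (i * k) * (2 ^ k * c'.N) := by gcongr
          _ = _ := by rw [add_mul, one_mul, pow_add]; ring
  obtain ⟨c, δ, hδ, -, -, hA, hinv, hμ, -⟩ := hiter K le_rfl
  have hδ0 : 0 < δ := hδ₀.trans_le hδ
  have : 0 < 1 / δ := by positivity
  -- After `K` rounds the bound on `1 / δ` is no longer positive.
  have hK' : 1 / δ₀ ≤ K / 32768 := by
    rw [le_div_iff₀ (by norm_num)]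
    linarith [(by ring : 1 / δ₀ * 32768 = 32768 / δ₀)]
  linarith

end CornerCell

/-! ### Choice of parameters and the final bound -/

/-- Here `δ₀ = 2 / x`. Constants are absorbed into powers of `x` by `2 ≤ x`, so that `m ≥ x ^ (-28 *
K)` and every requirement compares exponents. -/
theorem card_lt_of_pow_le {n K : ℕ} {x : ℝ} (hx : 2 ≤ x) (hK : 16384 * x ≤ K)
    (hK' : K ≤ 32768 * x) (hn : x ^ (238 * K) ≤ n)
    {A : Finset ((Fin n → ZMod 2) × (Fin n → ZMod 2))}
    (hA : IsCornerFree (A : Set ((Fin n → ZMod 2) × (Fin n → ZMod 2)))) :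
    (#A : ℝ) < 2 / x * ((2 : ℝ) ^ n) ^ 2 := by
  have hx0 : 0 < x := by linarith
  have hx1 : 1 ≤ x := by linarith
  have hK1 : (1 : ℝ) ≤ K := by linarith
  have hK1' : 1 ≤ K := by exact_mod_cast hK1
  set m : ℝ := ((2 / x) ^ 8 / 2 ^ 28) ^ K with hm
  set ε : ℝ := (2 / x) ^ 5 * m ^ 3 / 2048 with hε
  have hm0 : 0 < m := by positivity
  have hε0 : 0 < ε := by positivity
  have h2x : ∀ j : ℕ, (2 : ℝ) ^ j ≤ x ^ j := fun j => pow_le_pow_left₀ (by norm_num) hx j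
  have hmx : 1 ≤ m * x ^ (28 * K) := by
    rw [hm, pow_mul, ← mul_pow]
    refine one_le_pow₀ ?_
    have : (2 / x) ^ 8 / 2 ^ 28 * x ^ 28 = x ^ 20 / 2 ^ 20 := by field_simp
    rw [this, one_le_div (by positivity)]
    exact h2x 20
  have hεx : m ^ 3 ≤ ε * x ^ 11 := by
    have : ε * x ^ 11 = m ^ 3 * (x ^ 6 / 2 ^ 6) := by rw [hε]; field_simp; norm_num
    rw [this]
    refine le_mul_of_one_le_right (by positivity) ?_
    rw [one_le_div (by positivity)]
    exact h2x 6
  clear_value m ε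
  -- `m * ε ^ 2` is about `m ^ 7`, whence `196 = 7 * 28`; the `24` covers the factor `4` and the `x
  -- ^ 11` lost, squared, in `ε`.
  set k : ℕ := ⌈x ^ (24 + 196 * K)⌉₊ with hkdef
  have hk1 : x ^ (24 + 196 * K) ≤ k := Nat.le_ceil _
  have hk2 : (k : ℝ) ≤ 2 * x ^ (24 + 196 * K) := by
    have := Nat.ceil_lt_add_one (show 0 ≤ x ^ (24 + 196 * K) by positivity)
    have : 1 ≤ x ^ (24 + 196 * K) := one_le_pow₀ hx1
    linarith
  have hk : 4 ≤ k * m * ε ^ 2 := by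
    calc (4 : ℝ) ≤ x ^ 2 * 1 := by linarith [h2x 2]
      _ ≤ x ^ 2 * (m * x ^ (28 * K)) ^ 7 := by gcongr; exact one_le_pow₀ hmx
      _ = x ^ 2 * m * (m ^ 3) ^ 2 * x ^ (196 * K) := by
          rw [mul_pow, ← pow_mul x, show 28 * K * 7 = 196 * K by ring]; ring
      _ ≤ x ^ 2 * m * (ε * x ^ 11) ^ 2 * x ^ (196 * K) := by gcongr
      _ = x ^ (24 + 196 * K) * m * ε ^ 2 := by rw [pow_add]; ring
      _ ≤ k * m * ε ^ 2 := by gcongr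
  have hcard : (Fintype.card (Fin n → ZMod 2) : ℝ) = 2 ^ n := by simp [ZMod.card]
  -- Of these `K + 1` blocks, `K` pay for the halvings; the extra factor `2 ^ k` absorbs `16 / (δ₀ ^
  -- 3 * m ^ 2)`.
  have hnK : (K + 1) * k ≤ n := by
    have : ((K + 1 : ℕ) * k : ℝ) ≤ n := by
      refine le_trans ?_ hn
      push_cast
      calc ((K : ℝ) + 1) * k ≤ (2 * K) * (2 * x ^ (24 + 196 * K)) := by gcongr; linarith
        _ ≤ (2 * (32768 * x)) * (2 * x ^ (24 + 196 * K)) := by gcongr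
        _ = 2 ^ 17 * x ^ (25 + 196 * K) := by
            rw [show 25 + 196 * K = (24 + 196 * K) + 1 by ring, pow_succ]; ring
        _ ≤ x ^ 17 * x ^ (25 + 196 * K) := by gcongr
        _ = x ^ (42 + 196 * K) := by rw [← pow_add]; congr 1; ring
        _ ≤ x ^ (238 * K) := pow_le_pow_right₀ hx1 (by omega)
    exact_mod_cast this
  have hN : 16 * 2 ^ (K * k) ≤ (2 / x) ^ 3 * m ^ 2 * Fintype.card (Fin n → ZMod 2) := by
    rw [hcard]
    have h16 : 16 ≤ (2 / x) ^ 3 * m ^ 2 * 2 ^ k := by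
      calc (16 : ℝ) ≤ 2 ^ 3 * x ^ 1 * 1 := by linarith
        _ ≤ 2 ^ 3 * x ^ 1 * (m * x ^ (28 * K)) ^ 2 := by gcongr; exact one_le_pow₀ hmx
        _ = (2 / x) ^ 3 * m ^ 2 * x ^ (4 + 56 * K) := by
            rw [mul_pow, ← pow_mul x, show 28 * K * 2 = 56 * K by ring, pow_add]
            field_simp
        _ ≤ (2 / x) ^ 3 * m ^ 2 * k := by
            gcongr
            exact (pow_le_pow_right₀ hx1 (by omega)).trans hk1
        _ ≤ (2 / x) ^ 3 * m ^ 2 * 2 ^ k := by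
            gcongr
            exact_mod_cast Nat.lt_two_pow_self.le
    calc 16 * (2 : ℝ) ^ (K * k) ≤ (2 / x) ^ 3 * m ^ 2 * 2 ^ k * 2 ^ (K * k) := by gcongr
      _ = (2 / x) ^ 3 * m ^ 2 * 2 ^ ((K + 1) * k) := by rw [add_mul, one_mul, pow_add]; ring
      _ ≤ _ := by gcongr; norm_num
  have h2 : ∀ y : Fin n → ZMod 2, y + y = 0 := fun y => by
    funext i
    exact CharTwo.add_self_eq_zero (y i)
  have := CornerCell.card_lt_of_large h2 hA (δ₀ := 2 / x) (by positivity)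
    (by rw [div_div_eq_mul_div, div_le_iff₀ (by norm_num)]; linarith) hm hε hk hN
  rwa [hcard] at this

theorem card_lt_of_log_le {n : ℕ} (hn : 0 < n) {x : ℝ} (hx : 2 ≤ x)
    (hlog : 8000000 * (x * Real.log x) ≤ Real.log n)
    {A : Finset ((Fin n → ZMod 2) × (Fin n → ZMod 2))}
    (hA : IsCornerFree (A : Set ((Fin n → ZMod 2) × (Fin n → ZMod 2)))) :
    (#A : ℝ) < 2 / x * ((2 : ℝ) ^ n) ^ 2 := by
  have hx0 : 0 < x := by linarith
  have hlx : 0 ≤ Real.log x := Real.log_nonneg (by linarith)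
  have hK' : (⌈16384 * x⌉₊ : ℝ) ≤ 32768 * x := by
    have := Nat.ceil_lt_add_one (show 0 ≤ 16384 * x by positivity)
    linarith
  refine card_lt_of_pow_le hx (Nat.le_ceil _) hK' ?_ hA
  rw [← Real.log_le_log_iff (by positivity) (by exact_mod_cast hn), Real.log_pow]
  refine le_trans ?_ hlog
  push_cast
  calc 238 * (⌈16384 * x⌉₊ : ℝ) * Real.log x ≤ 238 * (32768 * x) * Real.log x := by gcongr
    _ ≤ _ := by
      have := mul_nonneg hx0.le hlx
      linarith

theorem cornerNumber_le_card_sq (n : ℕ) :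
    (cornerNumber (Fin n → ZMod 2) : ℝ) ≤ ((2 : ℝ) ^ n) ^ 2 := by
  obtain ⟨A, -, hA⟩ := (isGreatest_cornerNumber (Fin n → ZMod 2)).1
  rw [← hA]
  have := card_le_univ A
  rw [Fintype.card_prod, ← sq] at this
  have hcard : Fintype.card (Fin n → ZMod 2) = 2 ^ n := by simp [ZMod.card]
  rw [hcard] at this
  exact_mod_cast this

theorem theorem1 :
    ∃ C : ℝ, 0 < C ∧ ∀ n : ℕ, 4 ≤ n →
      (cornerNumber (Fin n → ZMod 2) : ℝ) ≤
        C * (((2 : ℝ) ^ n) ^ 2 *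
          (Real.log (Real.log (Real.log ((2 : ℝ) ^ n))) /
            Real.log (Real.log ((2 : ℝ) ^ n)))) := by
  have hl2 := Real.log_two_gt_d9
  set ℓ₄ : ℝ := Real.log (4 * Real.log 2) with hℓ₄
  have hℓ₄1 : 1 < ℓ₄ := by
    -- At `n = 4` the margin is thin: `4 * log 2 ≈ 2.77` against `e ≈ 2.72`.
    rw [hℓ₄, Real.lt_log_iff_exp_lt (by positivity)]
    linarith [Real.exp_one_lt_d9]
  have hL₄ : 0 < Real.log ℓ₄ := Real.log_pos hℓ₄1
  -- The first term serves the hypothesis of `card_lt_of_log_le`; the second gives `2 ≤ C * L`,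
  -- hence `x ≤ ℓ` below.
  set C : ℝ := 16000000 + 2 / Real.log ℓ₄ with hC
  have hC0 : 0 < C := by positivity
  refine ⟨C, hC0, fun n hn => ?_⟩
  rw [Real.log_pow]
  have hn4 : (4 : ℝ) ≤ n := by exact_mod_cast hn
  set ℓ : ℝ := Real.log (n * Real.log 2) with hℓ
  have hℓ4 : ℓ₄ ≤ ℓ := by
    rw [hℓ, hℓ₄]
    exact Real.log_le_log (by positivity) (by gcongr)
  have hℓ0 : 0 < ℓ := by linarith
  set L : ℝ := Real.log ℓ with hL
  have hLL : Real.log ℓ₄ ≤ L := Real.log_le_log (by linarith) hℓ4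
  have hL0 : 0 < L := hL₄.trans_le hLL
  rcases le_or_gt ℓ (C * L) with h | h
  · refine (cornerNumber_le_card_sq n).trans ?_
    have : 1 ≤ C * (L / ℓ) := by rw [← mul_div_assoc, one_le_div hℓ0]; exact h
    calc ((2 : ℝ) ^ n) ^ 2 ≤ ((2 : ℝ) ^ n) ^ 2 * (C * (L / ℓ)) :=
          le_mul_of_one_le_right (by positivity) this
      _ = _ := by ring
  · have hCL0 : 0 < C * L := by positivity
    have hCL : 2 ≤ C * L := by
      calc (2 : ℝ) = 2 / Real.log ℓ₄ * Real.log ℓ₄ := by field_simp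
        _ ≤ C * L := by gcongr; linarith
    -- This makes `2 / x` equal to the target density `C * L / ℓ`; the trivial bound handled the
    -- case where that is at least `1`.
    set x : ℝ := 2 * ℓ / (C * L) with hx
    have hx2 : 2 ≤ x := by rw [hx, le_div_iff₀ hCL0]; linarith
    have hxℓ : x ≤ ℓ := by rw [hx, div_le_iff₀ hCL0, mul_comm]; gcongr
    have hlog : 8000000 * (x * Real.log x) ≤ Real.log n := by
      calc 8000000 * (x * Real.log x) ≤ 8000000 * (x * L) := by
            gcongr
            exact Real.log_le_log (by linarith) hxℓ
        _ = 16000000 / C * ℓ := by rw [hx]; field_simp; norm_num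
        _ ≤ 1 * ℓ := by
            gcongr
            rw [div_le_one hC0, hC]
            have : 0 < 2 / Real.log ℓ₄ := by positivity
            linarith
        _ ≤ Real.log n := by
            rw [one_mul, hℓ]
            refine Real.log_le_log (by positivity) ?_
            refine mul_le_of_le_one_right (by positivity) ?_
            linarith [Real.log_two_lt_d9]
    obtain ⟨A, hA, hcard⟩ := (isGreatest_cornerNumber (Fin n → ZMod 2)).1
    rw [← hcard]
    refine (card_lt_of_log_le (by omega) hx2 hlog hA).le.trans (le_of_eq ?_)
    rw [hx]
    field_simp
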